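/- All graphs are finite and simple. The square $G^2$ of a graph $G$ has the same vertices as $G$, two distinct vertices being adjacent if and only if their distance in $G$ is at most two. A graph $G$ is squco (square-complementary) if $G^2$ is isomorphic to the complement $\overline{G}$. For a bipartite graph $J$ with bipartition $\{A,B\}$, its bipartite complement $\overline{J}^{\mathrm{bip}}$ has the same bipartition, and $a\in A$, $b\in B$ are adjacent in it if and only if they are not adjacent in $J$. For vertex-disjoint bipartite graphs $J,J'$ with bipartitions $\{A,B\}$ and $\{A',B'\}$, let $H(J,J')$ be the bipartite graph with bipartition $\{A\cup A'\cup C,\;B\cup B'\cup D\}$, where $C=\{c_1,c_2\}$ and $D=\{d_1,d_2\}$ consist of new vertices, and with edge set $E(J)\cup E(J')\cup\{c_1d_1,c_2d_2\}\cup AD\cup A'B\cup B'C$, where $XY=\{xy: x\in X,\,y\in Y\}$. Let $I(G)$ be the vertex-edge incidence graph of $G$, with bipartition $\{V(G),E(G)\}$, and let $G*K_2$ be the graph obtained from $G$ by adding two adjacent new vertices, both joined to all vertices of $G$. **Theorem.** The problem of recognizing squco graphs is graph isomorphism complete: it and the graph isomorphism problem are reducible to each other by polynomial-time many-one reductions (graphs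 being given by adjacency matrices). A reduction from graph isomorphism is given by incidence graphs, as follows. 1. Let $G_1,G_2$ be graphs with $|V(G_1)|=|V(G_2)|=n$, $|E(G_1)|=|E(G_2)|=m$ and $m>n>1$, such that none of the graphs $I(G_i)$ and $\overline{I(G_i)}^{\mathrm{bip}}$ ($i=1,2$) has an isolated vertex. Then $G_1\cong G_2$ if and only if $H\bigl(I(G_1),\overline{I(G_2)}^{\mathrm{bip}}\bigr)$ is squco. 2. Let $G_1,G_2$ be nonempty graphs with $|V(G_1)|=|V(G_2)|$ and $|E(G_1)|=|E(G_2)|$. Then $G_1\cong G_2$ if and only if $H\bigl(I(G_1*K_2),\overline{I(G_2*K_2)}^{\mathrm{bip}}\bigr)$ is squco. 3. There is a polynomial-time many-one reduction from graph isomorphism to the recognition of squco graphs that maps every pair $(G_1,G_2)$ as in 2 to a graph isomorphic to $H\bigl(I(G_1*K_2),\overline{I(G_2*K_2)}^{\mathrm{bip}}\bigr)$. -/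

import Mathlib

/-! ### Squares and square-complementary graphs -/

/-- The square of `G`: two distinct vertices are adjacent iff their distance in `G` is at most two
(`edist` is `⊤` for vertices in different components). -/
def SimpleGraph.square {V : Type*} (G : SimpleGraph V) : SimpleGraph V where
  Adj x y := x ≠ y ∧ G.edist x y ≤ 2
  symm := ⟨fun x y h => ⟨h.1.symm, by rw [SimpleGraph.edist_comm]; exact h.2⟩⟩
  loopless := ⟨fun _ h => h.1 rfl⟩

/-- `G` is square-complementary (squco): its square is isomorphic to its complement. -/
def SimpleGraph.IsSquco {V : Type*} (G : SimpleGraph V) : Prop :=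
  Nonempty (G.square ≃g Gᶜ)

/-- The graph `G * K₂` obtained from `G` by adding two universal vertices. -/
def SimpleGraph.pad {V : Type*} (G : SimpleGraph V) : SimpleGraph (V ⊕ Fin 2) :=
  (G ⊕g (⊤ : SimpleGraph (Fin 2))) ⊔ completeBipartiteGraph V (Fin 2)

/-- `G` has no isolated vertices. -/
def SimpleGraph.NoIsolated {V : Type*} (G : SimpleGraph V) : Prop :=
  ∀ v, ∃ w, G.Adj v w

/-! ### Bipartite graphs with a fixed bipartition -/

/-- A bipartite graph with a fixed bipartition into the left part `A` and the right part `B`,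
given by its edges between `A` and `B`. -/
structure BipGraph (A B : Type*) where
  /-- adjacency of a left vertex and a right vertex -/
  Adj : A → B → Prop

namespace BipGraph

/-- The underlying simple graph on the disjoint union of the two parts. -/
def toGraph {A B : Type*} (G : BipGraph A B) : SimpleGraph (A ⊕ B) where
  Adj
    | .inl a, .inr b => G.Adj a b
    | .inr b, .inl a => G.Adj a b
    | .inl _, .inl _ => False
    | .inr _, .inr _ => False
  symm := ⟨by rintro (a | b) (a' | b') h <;> exact h⟩
  loopless := ⟨by rintro (a | b) h <;> exact h⟩

/-- The bipartite complement: `a` and `b` in different parts are adjacent iff they were not. -/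
def compl {A B : Type*} (G : BipGraph A B) : BipGraph A B where
  Adj a b := ¬ G.Adj a b

/-- The graph `H(G, G')`. Its left part is `A ∪ A' ∪ C` and its right part is `B ∪ B' ∪ D`, with
`C = {c₁, c₂}` and `D = {d₁, d₂}`. Its edges are those of `G` and `G'`, the two edges `c₁d₁` and
`c₂d₂`, and all pairs in `AD`, `A'B` and `B'C`. -/
def H {A B A' B' : Type*} (G : BipGraph A B) (G' : BipGraph A' B') :
    BipGraph (A ⊕ A' ⊕ Fin 2) (B ⊕ B' ⊕ Fin 2) where
  Adj
    | .inl a, .inl b => G.Adj a b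
    | .inl _, .inr (.inl _) => False
    | .inl _, .inr (.inr _) => True
    | .inr (.inl _), .inl _ => True
    | .inr (.inl a'), .inr (.inl b') => G'.Adj a' b'
    | .inr (.inl _), .inr (.inr _) => False
    | .inr (.inr _), .inl _ => False
    | .inr (.inr _), .inr (.inl _) => True
    | .inr (.inr i), .inr (.inr j) => i = j

end BipGraph

/-- The vertex-edge incidence graph `I(G)`, with left part `V(G)` and right part `E(G)`. -/
def SimpleGraph.incidence {V : Type*} (G : SimpleGraph V) : BipGraph V G.edgeSet where
  Adj v e := v ∈ e.1

/-- The graph `H(I(G₁), J)`, where `J` is the bipartite complement of `I(G₂)`. -/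
def squcoGadget {V₁ V₂ : Type*} (G₁ : SimpleGraph V₁) (G₂ : SimpleGraph V₂) :
    SimpleGraph ((V₁ ⊕ V₂ ⊕ Fin 2) ⊕ (G₁.edgeSet ⊕ G₂.edgeSet ⊕ Fin 2)) :=
  (BipGraph.H G₁.incidence G₂.incidence.compl).toGraph

/-! ### Finite graphs as inputs of Turing machines -/

/-- A finite graph with vertex set `{0, …, n - 1}`. -/
structure FinGraph where
  /-- the number of vertices -/
  n : ℕ
  /-- the graph -/
  graph : SimpleGraph (Fin n)

open Classical in
/-- Row `i` of the adjacency matrix, followed by the end-of-row symbol `none`. -/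
noncomputable def FinGraph.encodeRow (G : FinGraph) (i : Fin G.n) : List (Option Bool) :=
  (List.finRange G.n).map (fun j => some (decide (G.graph.Adj i j))) ++ [none]

/-- The adjacency matrix of a graph, written row by row. -/
noncomputable def FinGraph.encode (G : FinGraph) : List (Option Bool) :=
  (List.finRange G.n).flatMap G.encodeRow

/-- A pair of graphs: the code of the first one followed by the code of the second one, over
disjoint copies of the alphabet. -/
noncomputable def FinGraph.encodePair (p : FinGraph × FinGraph) :
    List (Option Bool ⊕ Option Bool) :=
  p.1.encode.map Sum.inl ++ p.2.encode.map Sum.inr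

theorem FinGraph.encode_injective : Function.Injective FinGraph.encode := by
  have count : ∀ G : FinGraph, G.encode.count none = G.n := by
    intro G
    have h : ∀ i, (G.encodeRow i).count none = 1 := by
      intro i
      have h0 : (List.map (fun j => some (@decide (G.graph.Adj i j)
          (Classical.propDecidable _))) (List.finRange G.n)).count none = 0 := by
        rw [List.count_eq_zero]; simp
      unfold FinGraph.encodeRow
      rw [List.count_append, h0]; simp
    unfold FinGraph.encode
    rw [List.count_flatMap]
    have : List.count none ∘ G.encodeRow = fun _ => 1 := funext h
    rw [this]; simp
  have blocks : ∀ {α β : Type} (l : List α) (f g : α → List β),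
      (∀ x, (f x).length = (g x).length) → l.flatMap f = l.flatMap g →
      ∀ x ∈ l, f x = g x := by
    intro α β l f g hl
    induction l with
    | nil => simp
    | cons a l ih =>
      intro h x hx
      rw [List.flatMap_cons, List.flatMap_cons] at h
      obtain ⟨h1, h2⟩ := List.append_inj h (hl a)
      rcases List.mem_cons.1 hx with rfl | hx
      · exact h1
      · exact ih h2 x hx
  rintro ⟨n, G⟩ ⟨m, G'⟩ h
  have hn : n = m := by
    have := congrArg (List.count none) h
    rwa [count, count] at this
  subst hn
  congr 1
  ext i j
  have hi := blocks _ _ _ (by intro x; simp [FinGraph.encodeRow]) h i (List.mem_finRange i)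
  have h2 := (List.append_inj' hi rfl).1
  have h3 := List.map_inj_left.1 h2 j (List.mem_finRange j)
  simpa using h3

theorem FinGraph.encodePair_injective : Function.Injective FinGraph.encodePair := by
  rintro ⟨a, b⟩ ⟨c, d⟩ h
  have h1 := congrArg (List.filterMap (Sum.elim some fun _ => none)) h
  have h2 := congrArg (List.filterMap (Sum.elim (fun _ => none) some)) h
  simp only [FinGraph.encodePair, List.filterMap_append, List.filterMap_map] at h1 h2
  have e1 : (Sum.elim some fun _ => none) ∘ (Sum.inl : Option Bool → Option Bool ⊕ Option Bool)
      = some := rfl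
  have e2 : (Sum.elim some fun _ => (none : Option (Option Bool))) ∘
      (Sum.inr : Option Bool → Option Bool ⊕ Option Bool) = fun _ => none := rfl
  have e3 : (Sum.elim (fun _ => none) some) ∘
      (Sum.inr : Option Bool → Option Bool ⊕ Option Bool) = some := rfl
  have e4 : (Sum.elim (fun _ => (none : Option (Option Bool))) some) ∘
      (Sum.inl : Option Bool → Option Bool ⊕ Option Bool) = fun _ => none := rfl
  simp only [e1, e2] at h1
  simp only [e3, e4] at h2
  simp only [List.filterMap_some, List.filterMap_none, List.append_nil] at h1
  simp only [List.filterMap_some, List.filterMap_none, List.nil_append] at h2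
  rw [FinGraph.encode_injective h1, FinGraph.encode_injective h2]

/-! ### Decision problems and polynomial-time reductions -/

/-- A decision problem: a set of instances, each coded by a word over a finite alphabet, and the
set of yes-instances. -/
structure DecisionProblem where
  /-- the instances -/
  Inst : Type
  /-- the alphabet -/
  Sym : Type
  /-- the alphabet is finite -/
  symFintype : Fintype Sym
  /-- the code of an instance -/
  encode : Inst → List Sym
  /-- the code determines the instance -/
  encode_injective : Function.Injective encode
  /-- the yes-instances -/
  Yes : Inst → Prop

namespace DecisionProblem

/-- `f` is a polynomial-time many-one reduction from `P` to `Q`: a multi-stack Turing machine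
computes it in polynomial time, and it preserves both yes- and no-instances. -/
def IsReduction (P Q : DecisionProblem) (f : P.Inst → Q.Inst) : Prop :=
  Nonempty (Turing.TM2ComputableInPolyTime P.encode Q.encode f) ∧ ∀ x, P.Yes x ↔ Q.Yes (f x)

/-- `P` is polynomial-time many-one reducible to `Q`. -/
def Reducible (P Q : DecisionProblem) : Prop :=
  ∃ f : P.Inst → Q.Inst, IsReduction P Q f

/-- The graph isomorphism problem: given two finite graphs, are they isomorphic? -/
noncomputable def graphIso : DecisionProblem where
  Inst := FinGraph × FinGraph
  Sym := Option Bool ⊕ Option Bool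
  symFintype := inferInstance
  encode := FinGraph.encodePair
  encode_injective := FinGraph.encodePair_injective
  Yes p := Nonempty (p.1.graph ≃g p.2.graph)

/-- The problem of recognizing squco graphs: given a finite graph, is it squco? -/
noncomputable def squco : DecisionProblem where
  Inst := FinGraph
  Sym := Option Bool
  symFintype := inferInstance
  encode := FinGraph.encode
  encode_injective := FinGraph.encode_injective
  Yes G := G.graph.IsSquco

/-- `P` is graph isomorphism complete: `P` and the graph isomorphism problem are polynomial-time
many-one reducible to each other. -/
def GIComplete (P : DecisionProblem) : Prop :=
  Reducible graphIso P ∧ Reducible P graphIso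

end DecisionProblem

/-! # Recognizing squco graphs is graph isomorphism complete

*The gadget.* In `H(J, J')` any two vertices of the same part have a common neighbour, provided that
`J` and `J'` have no isolated vertices (`BipGraph.close_H`). For such a bipartite graph `K` the
square is the complement of the bipartite complement of `K` (`Close.square_eq`), so `K` is squco if
and only if it is isomorphic to its bipartite complement (`Close.isSquco_iff`). The bipartite
complement of `H(J, J')` is `H` of the complements of `J'` and `J` (`BipGraph.Iso.complH`). Hence
the complement of the gadget `H(I(G₁), J)`, with `J` the complement of `I(G₂)`, is the same gadget
with `G₁` and `G₂` exchanged, and the gadget is squco if `G₁` and `G₂` are isomorphic.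

Conversely, an isomorphism of the two gadgets cannot mix the parts, as vertices of different parts
have no common neighbour, and cannot exchange them if there are more edges than vertices
(`Close.exists_iso`). An edge of `G₁`, an edge of `G₂` and a vertex of `D` have degrees `n + 2`, `n`
and `n + 1` in the gadget, and the vertices of `G₁` are the left vertices adjacent to all of `D`. So
the isomorphism restricts to one of `I(G₁)` and `I(G₂)`, and incidence graphs determine their
graphs (`BipGraph.Iso.graphIso_of_H`, `SimpleGraph.isoOfIncidence`). Padding by two universal
vertices yields enough edges and no isolated vertices, and it can be undone because universal
vertices of a graph can be exchanged (`SimpleGraph.iso_of_pad`).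

*Polynomial time.* The reductions are written in a small language `WordProg`, whose programs write a
word by loops bounded by arithmetic terms; the terms can look up and count input symbols. Values and
running times of such programs are polynomially bounded, by induction on the program (`PolyBdd`).
They are translated to a loop language on unary registers (`Cmd`), which is in turn compiled to
machines with one stack per register (`machine`, `Run.steps`); see `polyTime_of_wordProg`. It then
suffices to write down a program for each reduction. A squco instance `G` is mapped to the pair of
its square and its complement. For the other direction the vertices of the gadget are coded by
triples of a kind and two numbers, so that the adjacency matrix is written by nested loops over the
codes (`toGadget`, `ofList_iso_gadget`). -/

open Turing

/-! ### A loop language on unary registers and its stack machine -/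

namespace RegMachine

/-- The memory of a loop program: an input word `inp`, whose scanned prefix is kept reversed in
`back`; an output word under construction, reversed in `rev`; the finished output `out`; and
registers holding natural numbers. -/
@[ext] structure Mem (I O : Type) where
  /-- the part of the input that has not been scanned -/
  inp : List I
  /-- the scanned part of the input, last symbol first -/
  back : List I
  /-- the output produced so far, last symbol first -/
  rev : List O
  /-- the output in its final order -/
  out : List O
  /-- the registers -/
  reg : ℕ → ℕ

/-- The basic instructions of the loop language. The last four run through a whole word. -/
inductive Atom (I O : Type)
  /-- increment a register -/
  | inc (r : ℕ)
  /-- decrement a register -/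
  | dec (r : ℕ)
  /-- do nothing -/
  | skip
  /-- append a symbol to the output -/
  | emit (o : O)
  /-- move one input symbol to the scanned part -/
  | shift
  /-- increment the register `r` if the next input symbol is `s` -/
  | test (s : I) (r : ℕ)
  /-- scan the whole input, adding the number of occurrences of `s` to the register `r` -/
  | count (s : I) (r : ℕ)
  /-- undo all scanning -/
  | rewind
  /-- erase the input -/
  | drain
  /-- put the output into its final order -/
  | flush

/-- Programs of the loop language. -/
inductive Cmd (I O : Type)
  /-- a basic instruction -/
  | atom (a : Atom I O)
  /-- sequential composition -/
  | seq (p q : Cmd I O)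
  /-- as long as the register `r` is positive, decrement it and run `p` -/
  | loop (r : ℕ) (p : Cmd I O)

variable {I O : Type}

namespace Mem

/-- Overwrite a register. -/
def setReg (m : Mem I O) (r v : ℕ) : Mem I O := { m with reg := Function.update m.reg r v }

theorem reg_setReg (m : Mem I O) (r v j : ℕ) :
    (m.setReg r v).reg j = if j = r then v else m.reg j := Function.update_apply ..

theorem setReg_self (m : Mem I O) (r : ℕ) {v : ℕ} (h : m.reg r = v) : m.setReg r v = m := by
  subst h; simp [setReg]

end Mem

section Semantics

variable [DecidableEq I]

/-- The effect of a basic instruction. -/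
def Atom.run : Atom I O → Mem I O → Mem I O
  | .inc r, m => m.setReg r (m.reg r + 1)
  | .dec r, m => m.setReg r (m.reg r - 1)
  | .skip, m => m
  | .emit o, m => { m with rev := o :: m.rev }
  | .shift, m => { m with inp := m.inp.tail, back := m.inp.head?.toList ++ m.back }
  | .test s r, m => m.setReg r (m.reg r + if m.inp.head? = some s then 1 else 0)
  | .count s r, m =>
    { m with
      inp := []
      back := m.inp.reverse ++ m.back
      reg := Function.update m.reg r (m.reg r + m.inp.count s) }
  | .rewind, m => { m with inp := m.back.reverse ++ m.inp, back := [] }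
  | .drain, m => { m with inp := [] }
  | .flush, m => { m with rev := [], out := m.rev.reverse ++ m.out }

/-- The number of machine steps of a basic instruction. -/
def Atom.cost : Atom I O → Mem I O → ℕ
  | .count _ _, m => m.inp.length + 1
  | .rewind, m => m.back.length + 1
  | .drain, m => m.inp.length + 1
  | .flush, m => m.rev.length + 1
  | _, _ => 1

/-- `Run p m m' t`: the program `p` started on `m` ends on `m'` after exactly `t` machine steps. -/
inductive Run : Cmd I O → Mem I O → Mem I O → ℕ → Prop
  | atom (a : Atom I O) (m : Mem I O) : Run (.atom a) m (a.run m) (a.cost m)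
  | seq {p q : Cmd I O} {m m' m'' : Mem I O} {t t' : ℕ} :
      Run p m m' t → Run q m' m'' t' → Run (.seq p q) m m'' (t + t')
  | loop_zero {r : ℕ} {p : Cmd I O} {m : Mem I O} : m.reg r = 0 → Run (.loop r p) m m 1
  | loop_succ {r : ℕ} {p : Cmd I O} {m m' m'' : Mem I O} {k t t' : ℕ} :
      m.reg r = k + 1 → Run p (m.setReg r k) m' t → Run (.loop r p) m' m'' t' →
      Run (.loop r p) m m'' (1 + t + t')

/-- A loop that runs through the memories `f 0, …, f n`. -/
theorem Run.loop_of {r : ℕ} {p : Cmd I O} {m m' : Mem I O} {t : ℕ} (n : ℕ) (f : ℕ → Mem I O)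
    (c : ℕ → ℕ) (h0 : f 0 = m) (hn : f n = m') (ht : 1 + ∑ i ∈ Finset.range n, (1 + c i) = t)
    (hr : ∀ i ≤ n, (f i).reg r = n - i)
    (hp : ∀ i < n, Run p ((f i).setReg r (n - (i + 1))) (f (i + 1)) (c i)) :
    Run (.loop r p) m m' t := by
  subst h0 hn ht
  induction n generalizing f c with
  | zero => exact Run.loop_zero (hr 0 le_rfl)
  | succ n ih =>
    have h1 := ih (fun i => f (i + 1)) (fun i => c (i + 1))
      (fun i hi => by rw [hr (i + 1) (by omega)]; omega)
      (fun i hi => by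
        have := hp (i + 1) (by omega)
        rwa [show n + 1 - (i + 1 + 1) = n - (i + 1) by omega] at this)
    have h2 := Run.loop_succ (hr 0 (Nat.zero_le _)) (hp 0 (Nat.succ_pos n)) h1
    convert h2 using 1
    rw [Finset.sum_range_succ']
    ring

end Semantics

/-- The registers of an instruction are below this number. -/
def Atom.width : Atom I O → ℕ
  | .inc r | .dec r | .test _ r | .count _ r => r + 1
  | _ => 0

/-- The registers of a program are below this number. -/
def Cmd.width : Cmd I O → ℕ
  | .atom a => a.width
  | .seq p q => max p.width q.width
  | .loop r p => max (r + 1) p.width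

/-! #### Compilation to stack machines -/

/-- The stacks of a machine for programs with registers below `N`. -/
inductive Stk (N : ℕ)
  | inp
  | back
  | rev
  | out
  | reg (i : Fin N)
  deriving DecidableEq, Fintype

/-- The alphabets of the stacks; registers are in unary. -/
def Alpha (I O : Type) (N : ℕ) : Stk N → Type
  | .inp | .back => I
  | .rev | .out => O
  | .reg _ => Unit

/-- The internal state of the machine: the last symbol read, or `none`. Between two steps it is
always `none`. -/
abbrev Var (I O : Type) : Type := Option (I ⊕ O ⊕ Unit)

/-- Labels of the machine code of a program. -/
def Cmd.Lab : Cmd I O → Type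
  | .atom _ => Unit
  | .seq p q => p.Lab ⊕ q.Lab
  | .loop _ p => Option p.Lab

/-- The label at which a program starts. -/
def Cmd.entry : (p : Cmd I O) → p.Lab
  | .atom _ => ()
  | .seq p _ => Sum.inl p.entry
  | .loop _ _ => none

/-- A program has finitely many labels. -/
@[reducible] noncomputable def Cmd.fintypeLab : (p : Cmd I O) → Fintype p.Lab
  | .atom _ => inferInstanceAs (Fintype Unit)
  | .seq p q => @instFintypeSum _ _ p.fintypeLab q.fintypeLab
  | .loop _ p => @instFintypeOption _ p.fintypeLab

section Code

variable {N : ℕ} {Λ : Type}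

/-- Reset the internal state and go to a label, or halt. -/
def leave : Option Λ → TM2.Stmt (Alpha I O N) Λ (Var I O)
  | some l => .load (fun _ => none) (.goto fun _ => l)
  | none => .load (fun _ => none) .halt

/-- The symbol of `I` in the internal state. -/
def getIn [Inhabited I] : Var I O → I
  | some (.inl x) => x
  | _ => default

/-- The symbol of `O` in the internal state. -/
def getOut [Inhabited O] : Var I O → O
  | some (.inr (.inl x)) => x
  | _ => default

/-- Push a mark on a register. -/
def pushReg (r : ℕ) (q : TM2.Stmt (Alpha I O N) Λ (Var I O)) : TM2.Stmt (Alpha I O N) Λ (Var I O) :=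
  if h : r < N then .push (.reg ⟨r, h⟩) (fun _ => ()) q else q

/-- Pop a mark from a register and record whether there was one. -/
def popReg (r : ℕ) (q : TM2.Stmt (Alpha I O N) Λ (Var I O)) : TM2.Stmt (Alpha I O N) Λ (Var I O) :=
  if h : r < N then .pop (.reg ⟨r, h⟩) (fun _ o => o.map fun _ => .inr (.inr ())) q else q

/-- The code of an instruction that sits at the label `self` and is followed by `exit`. -/
def Atom.code [DecidableEq I] [Inhabited I] [Inhabited O] (self : Λ) (exit : Option Λ) :
    Atom I O → TM2.Stmt (Alpha I O N) Λ (Var I O)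
  | .inc r => pushReg r (leave exit)
  | .dec r => popReg r (leave exit)
  | .skip => leave exit
  | .emit o => .push .rev (fun _ => o) (leave exit)
  | .shift => .pop .inp (fun _ (o : Option I) => o.map .inl)
      (.branch Option.isSome (.push .back getIn (leave exit)) (leave exit))
  | .test s r => .peek .inp (fun _ (o : Option I) => o.map .inl)
      (.branch (fun v => decide (v.isSome ∧ getIn v = s)) (pushReg r (leave exit)) (leave exit))
  | .count s r => .pop .inp (fun _ (o : Option I) => o.map .inl)
      (.branch Option.isSome
        (.push .back getIn
          (.branch (fun v => decide (getIn v = s)) (pushReg r (leave (some self)))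
            (leave (some self))))
        (leave exit))
  | .rewind => .pop .back (fun _ (o : Option I) => o.map .inl)
      (.branch Option.isSome (.push .inp getIn (leave (some self))) (leave exit))
  | .drain => .pop .inp (fun _ (o : Option I) => o.map .inl)
      (.branch Option.isSome (leave (some self)) (leave exit))
  | .flush => .pop .rev (fun _ (o : Option O) => o.map fun x => .inr (.inl x))
      (.branch Option.isSome (.push .out getOut (leave (some self))) (leave exit))

/-- The code of a program whose labels are placed by `emb` and which is followed by `exit`. -/
def Cmd.code [DecidableEq I] [Inhabited I] [Inhabited O] :
    (p : Cmd I O) → (p.Lab → Λ) → Option Λ → p.Lab → TM2.Stmt (Alpha I O N) Λ (Var I O)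
  | .atom a, emb, exit, l => a.code (emb l) exit
  | .seq p q, emb, _, .inl l => p.code (emb ∘ .inl) (some (emb (.inr q.entry))) l
  | .seq _ q, emb, exit, .inr l => q.code (emb ∘ .inr) exit l
  | .loop r p, emb, exit, none =>
      popReg r (.branch Option.isSome (leave (some (emb (some p.entry)))) (leave exit))
  | .loop _ p, emb, _, some l => p.code (emb ∘ some) (some (emb none)) l

/-- The stacks that represent a memory. -/
def Mem.stk (m : Mem I O) : ∀ k : Stk N, List (Alpha I O N k)
  | .inp => m.inp
  | .back => m.back
  | .rev => m.rev
  | .out => m.out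
  | .reg i => List.replicate (m.reg i) ()

/-- `t` steps of the machine `M` lead from the first to the second configuration. -/
def Steps (M : Λ → TM2.Stmt (Alpha I O N) Λ (Var I O)) (t : ℕ)
    (c c' : TM2.Cfg (Alpha I O N) Λ (Var I O)) : Prop :=
  (flip bind (TM2.step M))^[t] (some c) = some c'

theorem Steps.one {M : Λ → TM2.Stmt (Alpha I O N) Λ (Var I O)}
    {c c' : TM2.Cfg (Alpha I O N) Λ (Var I O)} (h : TM2.step M c = some c') : Steps M 1 c c' := h

theorem Steps.trans {M : Λ → TM2.Stmt (Alpha I O N) Λ (Var I O)} {t t' : ℕ}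
    {c c' c'' : TM2.Cfg (Alpha I O N) Λ (Var I O)} (h : Steps M t c c') (h' : Steps M t' c' c'') :
    Steps M (t + t') c c'' := by
  unfold Steps at *
  rw [add_comm, Function.iterate_add_apply, h, h']

theorem stepAux_leave (exit : Option Λ) (v : Var I O) (S : ∀ k : Stk N, List (Alpha I O N k)) :
    TM2.stepAux (leave exit) v S = ⟨exit, none, S⟩ := by
  cases exit <;> rfl

theorem Mem.update_inp (m : Mem I O) (l : List I) :
    Function.update (m.stk (N := N)) .inp l = Mem.stk { m with inp := l } := by
  funext k
  cases k <;> first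
    | exact Function.update_self ..
    | exact Function.update_of_ne (by simp) ..

theorem Mem.update_back (m : Mem I O) (l : List I) :
    Function.update (m.stk (N := N)) .back l = Mem.stk { m with back := l } := by
  funext k
  cases k <;> first
    | exact Function.update_self ..
    | exact Function.update_of_ne (by simp) ..

theorem Mem.update_rev (m : Mem I O) (l : List O) :
    Function.update (m.stk (N := N)) .rev l = Mem.stk { m with rev := l } := by
  funext k
  cases k <;> first
    | exact Function.update_self ..
    | exact Function.update_of_ne (by simp) ..

theorem Mem.update_out (m : Mem I O) (l : List O) :
    Function.update (m.stk (N := N)) .out l = Mem.stk { m with out := l } := by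
  funext k
  cases k <;> first
    | exact Function.update_self ..
    | exact Function.update_of_ne (by simp) ..

theorem Mem.update_reg (m : Mem I O) (r v : ℕ) (h : r < N) :
    Function.update (m.stk (N := N)) (.reg ⟨r, h⟩) (List.replicate v ()) =
      (m.setReg r v).stk := by
  funext k
  cases k with
  | reg i =>
    by_cases hi : i = ⟨r, h⟩
    · subst hi; simp [Mem.stk, Mem.setReg]
    · have : (i : ℕ) ≠ r := fun e => hi (Fin.ext e)
      rw [Function.update_of_ne (by simpa using hi)]
      simp [Mem.stk, Mem.setReg, this]
  | _ => exact Function.update_of_ne (by simp) ..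

theorem stepAux_pushReg (q : TM2.Stmt (Alpha I O N) Λ (Var I O)) (r : ℕ) (h : r < N) (v : Var I O)
    (m : Mem I O) :
    TM2.stepAux (pushReg r q) v m.stk = TM2.stepAux q v (m.setReg r (m.reg r + 1)).stk := by
  rw [pushReg, dif_pos h, ← Mem.update_reg _ _ _ h]
  rfl

theorem stepAux_popReg (q : TM2.Stmt (Alpha I O N) Λ (Var I O)) (r : ℕ) (h : r < N) (v : Var I O)
    (m : Mem I O) :
    TM2.stepAux (popReg r q) v m.stk =
      TM2.stepAux q (if m.reg r = 0 then none else some (.inr (.inr ())))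
        (m.setReg r (m.reg r - 1)).stk := by
  rw [popReg, dif_pos h, ← Mem.update_reg _ _ _ h]
  change TM2.stepAux q (Option.map _ ((m.stk (N := N)) (.reg ⟨r, h⟩)).head?)
    (Function.update _ _ ((m.stk (N := N)) (.reg ⟨r, h⟩)).tail) = _
  have : (m.stk (N := N)) (.reg ⟨r, h⟩) = List.replicate (m.reg r) () := rfl
  rw [this]
  cases m.reg r <;> rfl

end Code

end RegMachine

namespace RegMachine

variable {I O : Type} {N : ℕ} {Λ : Type}

/-! #### Correctness of the stack machine -/

theorem stepAux_pop_inp (m : Mem I O) (f : Var I O → Option I → Var I O) (v : Var I O)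
    (q : TM2.Stmt (Alpha I O N) Λ (Var I O)) :
    TM2.stepAux (.pop .inp f q) v m.stk =
      TM2.stepAux q (f v m.inp.head?) (Mem.stk { m with inp := m.inp.tail }) :=
  congrArg (TM2.stepAux q _) (Mem.update_inp m _)

theorem stepAux_pop_back (m : Mem I O) (f : Var I O → Option I → Var I O) (v : Var I O)
    (q : TM2.Stmt (Alpha I O N) Λ (Var I O)) :
    TM2.stepAux (.pop .back f q) v m.stk =
      TM2.stepAux q (f v m.back.head?) (Mem.stk { m with back := m.back.tail }) :=
  congrArg (TM2.stepAux q _) (Mem.update_back m _)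

theorem stepAux_pop_rev (m : Mem I O) (f : Var I O → Option O → Var I O) (v : Var I O)
    (q : TM2.Stmt (Alpha I O N) Λ (Var I O)) :
    TM2.stepAux (.pop .rev f q) v m.stk =
      TM2.stepAux q (f v m.rev.head?) (Mem.stk { m with rev := m.rev.tail }) :=
  congrArg (TM2.stepAux q _) (Mem.update_rev m _)

theorem stepAux_push_inp (m : Mem I O) (f : Var I O → I) (v : Var I O)
    (q : TM2.Stmt (Alpha I O N) Λ (Var I O)) :
    TM2.stepAux (.push .inp f q) v m.stk =
      TM2.stepAux q v (Mem.stk { m with inp := f v :: m.inp }) :=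
  congrArg (TM2.stepAux q _) (Mem.update_inp m _)

theorem stepAux_push_back (m : Mem I O) (f : Var I O → I) (v : Var I O)
    (q : TM2.Stmt (Alpha I O N) Λ (Var I O)) :
    TM2.stepAux (.push .back f q) v m.stk =
      TM2.stepAux q v (Mem.stk { m with back := f v :: m.back }) :=
  congrArg (TM2.stepAux q _) (Mem.update_back m _)

theorem stepAux_push_rev (m : Mem I O) (f : Var I O → O) (v : Var I O)
    (q : TM2.Stmt (Alpha I O N) Λ (Var I O)) :
    TM2.stepAux (.push .rev f q) v m.stk =
      TM2.stepAux q v (Mem.stk { m with rev := f v :: m.rev }) :=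
  congrArg (TM2.stepAux q _) (Mem.update_rev m _)

theorem stepAux_push_out (m : Mem I O) (f : Var I O → O) (v : Var I O)
    (q : TM2.Stmt (Alpha I O N) Λ (Var I O)) :
    TM2.stepAux (.push .out f q) v m.stk =
      TM2.stepAux q v (Mem.stk { m with out := f v :: m.out }) :=
  congrArg (TM2.stepAux q _) (Mem.update_out m _)

theorem stepAux_peek_inp (m : Mem I O) (f : Var I O → Option I → Var I O) (v : Var I O)
    (q : TM2.Stmt (Alpha I O N) Λ (Var I O)) :
    TM2.stepAux (.peek .inp f q) v m.stk = TM2.stepAux q (f v m.inp.head?) m.stk := rfl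

variable {M : Λ → TM2.Stmt (Alpha I O N) Λ (Var I O)} {self : Λ} {exit : Option Λ}

theorem Steps.of_code {c' : TM2.Cfg (Alpha I O N) Λ (Var I O)}
    {q : TM2.Stmt (Alpha I O N) Λ (Var I O)} (hM : M self = q)
    {S : ∀ k : Stk N, List (Alpha I O N k)} (h : TM2.stepAux q none S = c') :
    Steps M 1 ⟨some self, none, S⟩ c' :=
  Steps.one (by rw [← h, ← hM]; rfl)

variable [DecidableEq I] [Inhabited I] [Inhabited O]

theorem Atom.steps_count (s : I) (r : ℕ) (hr : r < N)
    (hM : M self = (Atom.count s r).code self exit) (l : List I) :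
    ∀ m : Mem I O, m.inp = l → Steps M (l.length + 1) ⟨some self, none, m.stk⟩
      ⟨exit, none, ((Atom.count s r).run m).stk⟩ := by
  induction l with
  | nil =>
    intro m hm
    refine Steps.of_code hM ?_
    have : (Atom.count s r).run m = { m with inp := [] } := by
      simp [Atom.run, hm]
    simp [Atom.code, stepAux_pop_inp, hm, stepAux_leave, this]
  | cons x l ih =>
    intro m hm
    set m' : Mem I O := Mem.setReg { m with inp := l, back := x :: m.back } r
      (m.reg r + if x = s then 1 else 0) with hm'
    have h1 : Steps M 1 ⟨some self, none, m.stk⟩ ⟨some self, none, m'.stk⟩ := by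
      refine Steps.of_code hM ?_
      by_cases hx : x = s
      · simp [Atom.code, stepAux_pop_inp, stepAux_push_back, stepAux_pushReg _ _ hr, hm,
          stepAux_leave, getIn, hx, hm']
      · simp [Atom.code, stepAux_pop_inp, stepAux_push_back, hm, stepAux_leave, getIn, hx, hm',
          Mem.setReg]
    have h2 := h1.trans (ih m' rfl)
    have : (Atom.count s r).run m' = (Atom.count s r).run m := by
      simp [Atom.run, hm, hm', Mem.setReg, List.count_cons, add_assoc, add_comm]
    rw [this] at h2
    rwa [List.length_cons, add_comm]

theorem Atom.steps_rewind (hM : M self = (Atom.rewind : Atom I O).code self exit) (l : List I) :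
    ∀ m : Mem I O, m.back = l → Steps M (l.length + 1) ⟨some self, none, m.stk⟩
      ⟨exit, none, (Atom.rewind.run m).stk⟩ := by
  induction l with
  | nil =>
    intro m hm
    refine Steps.of_code hM ?_
    simp [Atom.code, Atom.run, stepAux_pop_back, hm, stepAux_leave]
  | cons x l ih =>
    intro m hm
    have h1 : Steps M 1 ⟨some self, none, m.stk⟩
        ⟨some self, none, Mem.stk { m with inp := x :: m.inp, back := l }⟩ := by
      refine Steps.of_code hM ?_
      simp [Atom.code, stepAux_pop_back, stepAux_push_inp, hm, stepAux_leave, getIn]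
    have h2 := h1.trans (ih _ rfl)
    have : Atom.rewind.run { m with inp := x :: m.inp, back := l } = Atom.rewind.run m := by
      simp [Atom.run, hm]
    rw [this] at h2
    rwa [List.length_cons, add_comm]

theorem Atom.steps_drain (hM : M self = (Atom.drain : Atom I O).code self exit) (l : List I) :
    ∀ m : Mem I O, m.inp = l → Steps M (l.length + 1) ⟨some self, none, m.stk⟩
      ⟨exit, none, (Atom.drain.run m).stk⟩ := by
  induction l with
  | nil =>
    intro m hm
    refine Steps.of_code hM ?_
    simp [Atom.code, Atom.run, stepAux_pop_inp, hm, stepAux_leave]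
  | cons x l ih =>
    intro m hm
    have h1 : Steps M 1 ⟨some self, none, m.stk⟩
        ⟨some self, none, Mem.stk { m with inp := l }⟩ := by
      refine Steps.of_code hM ?_
      simp [Atom.code, stepAux_pop_inp, hm, stepAux_leave]
    have h2 := h1.trans (ih _ rfl)
    rwa [List.length_cons, add_comm]

theorem Atom.steps_flush (hM : M self = (Atom.flush : Atom I O).code self exit) (l : List O) :
    ∀ m : Mem I O, m.rev = l → Steps M (l.length + 1) ⟨some self, none, m.stk⟩
      ⟨exit, none, (Atom.flush.run m).stk⟩ := by
  induction l with
  | nil =>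
    intro m hm
    refine Steps.of_code hM ?_
    simp [Atom.code, Atom.run, stepAux_pop_rev, hm, stepAux_leave]
  | cons x l ih =>
    intro m hm
    have h1 : Steps M 1 ⟨some self, none, m.stk⟩
        ⟨some self, none, Mem.stk { m with out := x :: m.out, rev := l }⟩ := by
      refine Steps.of_code hM ?_
      simp [Atom.code, stepAux_pop_rev, stepAux_push_out, hm, stepAux_leave, getOut]
    have h2 := h1.trans (ih _ rfl)
    have : Atom.flush.run { m with out := x :: m.out, rev := l } = Atom.flush.run m := by
      simp [Atom.run, hm]
    rw [this] at h2
    rwa [List.length_cons, add_comm]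

/-- The machine code of an instruction carries it out, in the number of steps given by its cost. -/
theorem Atom.steps (a : Atom I O) (m : Mem I O) (hw : a.width ≤ N)
    (hM : M self = a.code self exit) :
    Steps M (a.cost m) ⟨some self, none, m.stk⟩ ⟨exit, none, (a.run m).stk⟩ := by
  cases a with
  | inc r =>
    refine Steps.of_code hM ?_
    simp [Atom.code, Atom.run, stepAux_pushReg _ r hw, stepAux_leave]
  | dec r =>
    refine Steps.of_code hM ?_
    simp [Atom.code, Atom.run, stepAux_popReg _ r hw, stepAux_leave]
  | skip =>
    refine Steps.of_code hM ?_
    simp [Atom.code, Atom.run, stepAux_leave]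
  | emit o =>
    refine Steps.of_code hM ?_
    simp [Atom.code, Atom.run, stepAux_push_rev, stepAux_leave]
  | shift =>
    refine Steps.of_code hM ?_
    cases h : m.inp <;>
      simp [Atom.code, Atom.run, stepAux_pop_inp, stepAux_push_back, stepAux_leave, h, getIn]
  | test s r =>
    refine Steps.of_code hM ?_
    cases h : m.inp with
    | nil => simp [Atom.code, Atom.run, stepAux_peek_inp, stepAux_leave, h, Mem.setReg_self]
    | cons x l =>
      by_cases hx : x = s <;>
        simp [Atom.code, Atom.run, stepAux_peek_inp, stepAux_leave, stepAux_pushReg _ r hw, h,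
          getIn, hx, Mem.setReg_self]
  | count s r => exact Atom.steps_count s r hw hM _ m rfl
  | rewind => exact Atom.steps_rewind hM _ m rfl
  | drain => exact Atom.steps_drain hM _ m rfl
  | flush => exact Atom.steps_flush hM _ m rfl

/-- The machine code of a program carries out its runs, in the same number of steps. -/
theorem Run.steps {p : Cmd I O} {m m' : Mem I O} {t : ℕ} (h : Run p m m' t) :
    ∀ (emb : p.Lab → Λ) (exit : Option Λ), p.width ≤ N → (∀ l, M (emb l) = p.code emb exit l) →
      Steps M t ⟨some (emb p.entry), none, m.stk⟩ ⟨exit, none, m'.stk⟩ := by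
  induction h with
  | atom a m =>
    intro emb exit hw hM
    exact Atom.steps a m hw (hM ())
  | seq _ _ ih ih' =>
    intro emb exit hw hM
    have hw' := max_le_iff.1 hw
    exact (ih (emb ∘ .inl) _ hw'.1 fun l => hM (.inl l)).trans
      (ih' (emb ∘ .inr) exit hw'.2 fun l => hM (.inr l))
  | loop_zero h0 =>
    intro emb exit hw hM
    have hw' := max_le_iff.1 hw
    refine Steps.of_code (hM none) ?_
    have := Mem.setReg_self _ _ h0
    simp [Cmd.code, stepAux_popReg _ _ hw'.1, stepAux_leave, h0, this]
  | @loop_succ r p m m' m'' k t t' hk _ _ ih ih' =>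
    intro emb exit hw hM
    have hw' := max_le_iff.1 hw
    have h1 : Steps M 1 ⟨some (emb none), none, m.stk⟩
        ⟨some (emb (some p.entry)), none, (m.setReg r k).stk⟩ := by
      refine Steps.of_code (hM none) ?_
      simp [Cmd.code, stepAux_popReg _ _ hw'.1, stepAux_leave, hk]
    exact (h1.trans (ih (emb ∘ some) _ hw'.2 fun l => hM (some l))).trans (ih' emb exit hw hM)

/-- The memory with input `w` and everything else empty. -/
def Mem.ofInput (w : List I) : Mem I O := ⟨w, [], [], [], fun _ => 0⟩

/-- The memory with finished output `w` and everything else empty. -/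
def Mem.ofOutput (w : List O) : Mem I O := ⟨[], [], [], w, fun _ => 0⟩

/-- The stack machine of a program. -/
noncomputable def machine [Fintype I] [Fintype O] (p : Cmd I O) : FinTM2 where
  K := Stk p.width
  k₀ := .inp
  k₁ := .out
  Γ := Alpha I O p.width
  Λ := p.Lab
  main := p.entry
  ΛFin := p.fintypeLab
  σ := Var I O
  initialState := none
  Γk₀Fin := inferInstanceAs (Fintype I)
  m := p.code id none

/-- A function computed by a loop program in polynomially many steps is computable in polynomial
time. -/
theorem polyTime_of_run [Fintype I] [Fintype O] {α β : Type} {ea : α → List I} {eb : β → List O}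
    {f : α → β} (p : Cmd I O) (time : Polynomial ℕ)
    (h : ∀ a, ∃ t ≤ time.eval (ea a).length,
      Run p (Mem.ofInput (ea a)) (Mem.ofOutput (eb (f a))) t) :
    Nonempty (TM2ComputableInPolyTime ea eb f) := by
  refine ⟨⟨⟨machine p, Equiv.refl I, Equiv.refl O⟩, time, fun a => ?_⟩⟩
  choose t ht hrun using h
  refine ⟨⟨t a, ?_⟩, ht a⟩
  have h := (hrun a).steps (M := p.code (N := p.width) id none) id none le_rfl fun _ => rfl
  have h1 : initList (machine p) (List.map (Equiv.refl I).invFun (ea a)) =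
      ⟨some p.entry, none, Mem.stk (N := p.width) (Mem.ofInput (O := O) (ea a))⟩ := by
    unfold initList
    congr 1
    funext k
    cases k
    · exact (List.map_id _)
    all_goals rfl
  have h2 : haltList (machine p) (List.map (Equiv.refl O).invFun (eb (f a))) =
      ⟨none, none, Mem.stk (N := p.width) (Mem.ofOutput (I := I) (eb (f a)))⟩ := by
    unfold haltList
    congr 1
    funext k
    cases k
    case out => exact (List.map_id _)
    all_goals rfl
  exact (congrArg (fun c => (flip bind (FinTM2.step (machine p)))^[t a] (some c)) h1).trans
    (Eq.trans h (congrArg some h2.symm))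

end RegMachine

namespace RegMachine

/-! ### Arithmetic terms with bounded sums and word programs -/

/-- Terms for natural numbers that depend on an input word and on variables. -/
inductive Expr (I : Type)
  /-- a variable -/
  | var (x : ℕ)
  /-- the number one -/
  | one
  /-- sum -/
  | add (a b : Expr I)
  /-- truncated difference -/
  | sub (a b : Expr I)
  /-- product -/
  | mul (a b : Expr I)
  /-- the sum of the values of `b` over all values of the variable `x` below `a` -/
  | sum (x : ℕ) (a b : Expr I)
  /-- whether the symbol `s` stands at position `a` of the input -/
  | look (s : I) (a : Expr I)
  /-- the number of occurrences of `s` in the input -/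
  | count (s : I)

/-- Programs that write a word. -/
inductive WordProg (I O : Type)
  /-- write a symbol -/
  | emit (o : O)
  /-- write two words -/
  | seq (p q : WordProg I O)
  /-- write the words given by `p` for all values of the variable `x` below `a` -/
  | rep (x : ℕ) (a : Expr I) (p : WordProg I O)

variable {I O : Type} [DecidableEq I]

namespace Expr

/-- The value of a term on an input word `w`. -/
def eval (w : List I) : Expr I → (ℕ → ℕ) → ℕ
  | var x, v => v x
  | one, _ => 1
  | add a b, v => a.eval w v + b.eval w v
  | sub a b, v => a.eval w v - b.eval w v
  | mul a b, v => a.eval w v * b.eval w v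
  | sum x a b, v => ∑ i ∈ Finset.range (a.eval w v), b.eval w (Function.update v x i)
  | look s a, v => if w[a.eval w v]? = some s then 1 else 0
  | count s, _ => w.count s

/-- A program that adds the value of a term to the register `d`. The variable `x` is kept in the
register `ρ x`, and the registers from `k` on are free. -/
def cmd : Expr I → (ℕ → ℕ) → ℕ → ℕ → Cmd I O
  | var x, ρ, d, k =>
      -- reading a register empties it, so it is restored from a copy
      .seq (.loop (ρ x) (.seq (.atom (.inc k)) (.atom (.inc d))))
        (.loop k (.atom (.inc (ρ x))))
  | one, _, d, _ => .atom (.inc d)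
  | add a b, ρ, d, k => .seq (a.cmd ρ d k) (b.cmd ρ d k)
  | sub a b, ρ, d, k =>
      .seq (a.cmd ρ k (k + 2)) (.seq (b.cmd ρ (k + 1) (k + 2))
        (.seq (.loop (k + 1) (.atom (.dec k))) (.loop k (.atom (.inc d)))))
  | mul a b, ρ, d, k => .seq (a.cmd ρ k (k + 1)) (.loop k (b.cmd ρ d (k + 1)))
  | sum x a b, ρ, d, k =>
      -- the register `k` counts down, the register `k + 1` holds the bound variable
      .seq (a.cmd ρ k (k + 2)) (.seq
        (.loop k (.seq (b.cmd (Function.update ρ x (k + 1)) d (k + 2)) (.atom (.inc (k + 1)))))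
        (.loop (k + 1) (.atom .skip)))
  | look s a, ρ, d, k =>
      .seq (a.cmd ρ k (k + 1)) (.seq (.loop k (.atom .shift))
        (.seq (.atom (.test s d)) (.atom .rewind)))
  | count s, _, d, _ => .seq (.atom (.count s d)) (.atom .rewind)

/-- The running time of `Expr.cmd`. -/
def cost (w : List I) : Expr I → (ℕ → ℕ) → ℕ
  | var x, v => (1 + ∑ _i ∈ Finset.range (v x), (1 + (1 + 1))) +
      (1 + ∑ _i ∈ Finset.range (v x), (1 + 1))
  | one, _ => 1
  | add a b, v => a.cost w v + b.cost w v
  | sub a b, v => a.cost w v + (b.cost w v +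
      ((1 + ∑ _i ∈ Finset.range (b.eval w v), (1 + 1)) +
        (1 + ∑ _i ∈ Finset.range (a.eval w v - b.eval w v), (1 + 1))))
  | mul a b, v => a.cost w v + (1 + ∑ _i ∈ Finset.range (a.eval w v), (1 + b.cost w v))
  | sum x a b, v => a.cost w v +
      ((1 + ∑ i ∈ Finset.range (a.eval w v), (1 + (b.cost w (Function.update v x i) + 1))) +
        (1 + ∑ _i ∈ Finset.range (a.eval w v), (1 + 1)))
  | look _ a, v => a.cost w v + ((1 + ∑ _i ∈ Finset.range (a.eval w v), (1 + 1)) +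
      (1 + (min (a.eval w v) w.length + 1)))
  | count _, _ => (w.length + 1) + (w.length + 1)

end Expr

theorem Run.of_eq {p : Cmd I O} {m m' m'' : Mem I O} {t : ℕ} (h : Run p m m' t) (e : m' = m'') :
    Run p m m'' t := e ▸ h

theorem Run.congr_left {p : Cmd I O} {m m' m'' : Mem I O} {t : ℕ} (h : Run p m m' t)
    (e : m = m'') : Run p m'' m' t := e ▸ h

/-- The memory after `i` input symbols have been scanned. -/
def Mem.scan (m : Mem I O) (w : List I) (i : ℕ) : Mem I O :=
  { m with inp := w.drop i, back := (w.take i).reverse }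

theorem Mem.shift_scan (m : Mem I O) (w : List I) (i : ℕ) :
    Atom.shift.run (m.scan w i) = m.scan w (i + 1) := by
  simp only [Atom.run, Mem.scan, List.tail_drop, List.head?_drop]
  congr 1
  rw [List.take_add_one, List.reverse_append]
  cases w[i]? <;> rfl

/-- `Expr.cmd` adds the value of the term to the register `d` and restores everything else; the free
registers are zero before and after. -/
theorem Expr.run (w : List I) (e : Expr I) :
    ∀ (ρ : ℕ → ℕ) (d k : ℕ) (m : Mem I O), d < k → (∀ x, ρ x < k) → (∀ x, ρ x ≠ d) →
      (∀ r, k ≤ r → m.reg r = 0) → m.inp = w → m.back = [] →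
      Run (e.cmd ρ d k) m (m.setReg d (m.reg d + e.eval w (m.reg ∘ ρ)))
        (e.cost w (m.reg ∘ ρ)) := by
  induction e with
  | var x =>
    intro ρ d k m hd hρ hne h0 hi hb
    have hx := hρ x
    have hxd := hne x
    have h0k := h0 k le_rfl
    have he : eval w (var x) (m.reg ∘ ρ) = m.reg (ρ x) := rfl
    set a := m.reg (ρ x) with ha
    refine Run.seq (m' := ((m.setReg (ρ x) 0).setReg k a).setReg d (m.reg d + a)) ?_ ?_
    · refine Run.loop_of a
        (fun i => ((m.setReg (ρ x) (a - i)).setReg k i).setReg d (m.reg d + i)) (fun _ => 1 + 1)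
        (Mem.ext rfl rfl rfl rfl (funext fun j => ?_)) ?_ rfl (fun i hi => ?_) (fun i hi =>
          Run.of_eq (Run.seq (Run.atom _ _) (Run.atom _ _))
          (Mem.ext rfl rfl rfl rfl (funext fun j => ?_)))
      · grind [Mem.reg_setReg]
      · simp
      · grind [Mem.reg_setReg]
      · grind [Mem.reg_setReg, Atom.run]
    · refine Run.loop_of a
        (fun i => ((m.setReg (ρ x) i).setReg k (a - i)).setReg d (m.reg d + a)) (fun _ => 1)
        rfl (Mem.ext rfl rfl rfl rfl (funext fun j => ?_)) rfl (fun i hi => ?_) (fun i hi =>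
          Run.of_eq (Run.atom _ _) (Mem.ext rfl rfl rfl rfl (funext fun j => ?_)))
      · grind [Mem.reg_setReg]
      · grind [Mem.reg_setReg]
      · grind [Mem.reg_setReg, Atom.run]
  | one =>
    intro ρ d k m hd hρ hne h0 hi hb
    exact Run.atom _ _
  | add a b iha ihb =>
    intro ρ d k m hd hρ hne h0 hi hb
    have ha := iha ρ d k m hd hρ hne h0 hi hb
    set m' := m.setReg d (m.reg d + a.eval w (m.reg ∘ ρ)) with hm'
    have hc : m'.reg ∘ ρ = m.reg ∘ ρ := by
      funext x; simp [hm', Mem.reg_setReg, hne x]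
    have hb := ihb ρ d k m' hd hρ hne (fun r hr => by grind [Mem.reg_setReg]) hi hb
    rw [hc] at hb
    refine Run.of_eq (Run.seq ha hb) ?_
    simp [hm', Mem.setReg, eval, add_assoc]
  | sub a b iha ihb =>
    intro ρ d k m hd hρ hne h0 hi hb
    have h0k := h0 k le_rfl
    have h0k' := h0 (k + 1) (by omega)
    have ha := iha ρ k (k + 2) m (by omega) (fun x => (hρ x).trans (by omega))
      (fun x => (hρ x).ne) (fun r hr => h0 r (by omega)) hi hb
    set u := a.eval w (m.reg ∘ ρ) with hu
    set m' := m.setReg k (m.reg k + u) with hm'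
    have hc : m'.reg ∘ ρ = m.reg ∘ ρ := by
      funext x; simp [hm', Mem.reg_setReg, (hρ x).ne]
    have hb := ihb ρ (k + 1) (k + 2) m' (by omega) (fun x => (hρ x).trans (by omega))
      (fun x => ((hρ x).trans (by omega)).ne) (fun r hr => by grind [Mem.reg_setReg]) hi hb
    rw [hc] at hb
    set v := b.eval w (m.reg ∘ ρ) with hv
    have he : eval w (sub a b) (m.reg ∘ ρ) = u - v := rfl
    refine Run.seq ha (Run.seq hb (Run.seq (m' := m.setReg k (u - v)) ?_ ?_))
    · refine Run.loop_of v
        (fun i => (m.setReg k (u - i)).setReg (k + 1) (v - i)) (fun _ => 1)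
        (Mem.ext rfl rfl rfl rfl (funext fun j => ?_))
        (Mem.ext rfl rfl rfl rfl (funext fun j => ?_)) rfl (fun i hi => ?_) (fun i hi =>
          Run.of_eq (Run.atom _ _) (Mem.ext rfl rfl rfl rfl (funext fun j => ?_)))
      · grind [Mem.reg_setReg]
      · grind [Mem.reg_setReg]
      · grind [Mem.reg_setReg]
      · grind [Mem.reg_setReg, Atom.run]
    · refine Run.loop_of (u - v)
        (fun i => (m.setReg k (u - v - i)).setReg d (m.reg d + i)) (fun _ => 1)
        (Mem.ext rfl rfl rfl rfl (funext fun j => ?_))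
        (Mem.ext rfl rfl rfl rfl (funext fun j => ?_)) rfl (fun i hi => ?_) (fun i hi =>
          Run.of_eq (Run.atom _ _) (Mem.ext rfl rfl rfl rfl (funext fun j => ?_)))
      · grind [Mem.reg_setReg]
      · grind [Mem.reg_setReg]
      · grind [Mem.reg_setReg]
      · grind [Mem.reg_setReg, Atom.run]
  | mul a b iha ihb =>
    intro ρ d k m hd hρ hne h0 hi hb
    have h0k := h0 k le_rfl
    have ha := iha ρ k (k + 1) m (by omega) (fun x => (hρ x).trans (by omega))
      (fun x => (hρ x).ne) (fun r hr => h0 r (by omega)) hi hb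
    set v := m.reg ∘ ρ with hv
    set n := a.eval w v with hn
    set u := b.eval w v with hu
    have he : eval w (mul a b) v = n * u := rfl
    refine Run.seq ha (Run.loop_of n
      (fun i => (m.setReg k (n - i)).setReg d (m.reg d + i * u)) (fun _ => b.cost w v)
        (Mem.ext rfl rfl rfl rfl (funext fun j => ?_))
        (Mem.ext rfl rfl rfl rfl (funext fun j => ?_)) rfl (fun i hi => ?_) (fun i hin => ?_))
    · grind [Mem.reg_setReg]
    · grind [Mem.reg_setReg]
    · grind [Mem.reg_setReg]
    · set m'' : Mem I O := ((m.setReg k (n - i)).setReg d (m.reg d + i * u)).setReg k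
        (n - (i + 1)) with hm''
      have hc : m''.reg ∘ ρ = v := by
        funext y
        have := hρ y
        have := hne y
        have hy : v y = m.reg (ρ y) := rfl
        simp only [Function.comp]
        grind [Mem.reg_setReg]
      have hb' := ihb ρ d (k + 1) m'' (by omega) (fun y => (hρ y).trans (by omega)) hne
        (fun r hr => by
          have := h0 r (by omega)
          grind [Mem.reg_setReg]) hi hb
      rw [hc] at hb'
      refine Run.of_eq hb' (Mem.ext rfl rfl rfl rfl (funext fun j => ?_))
      have : (i + 1) * u = i * u + u := by ring
      grind [Mem.reg_setReg]
  | sum x a b iha ihb =>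
    intro ρ d k m hd hρ hne h0 hi hb
    have h0k := h0 k le_rfl
    have h0k' := h0 (k + 1) (by omega)
    have ha := iha ρ k (k + 2) m (by omega) (fun x => (hρ x).trans (by omega))
      (fun x => (hρ x).ne) (fun r hr => h0 r (by omega)) hi hb
    set v := m.reg ∘ ρ with hv
    set n := a.eval w v with hn
    let S : ℕ → ℕ := fun i => ∑ j ∈ Finset.range i, b.eval w (Function.update v x j)
    have hS : ∀ i, S (i + 1) = S i + b.eval w (Function.update v x i) :=
      fun i => Finset.sum_range_succ _ _
    have hS0 : S 0 = 0 := rfl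
    have he : eval w (sum x a b) v = S n := rfl
    clear_value S
    refine Run.seq ha (Run.seq (m' := (m.setReg (k + 1) n).setReg d (m.reg d + S n)) ?_ ?_)
    · refine Run.loop_of n
        (fun i => ((m.setReg k (n - i)).setReg (k + 1) i).setReg d (m.reg d + S i))
        (fun i => b.cost w (Function.update v x i) + 1)
        (Mem.ext rfl rfl rfl rfl (funext fun j => ?_))
        (Mem.ext rfl rfl rfl rfl (funext fun j => ?_)) rfl (fun i hi => ?_) (fun i hin => ?_)
      · grind [Mem.reg_setReg]
      · grind [Mem.reg_setReg]
      · grind [Mem.reg_setReg]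
      · set m'' : Mem I O := (((m.setReg k (n - i)).setReg (k + 1) i).setReg d
          (m.reg d + S i)).setReg k (n - (i + 1)) with hm''
        have hc : m''.reg ∘ (Function.update ρ x (k + 1)) = Function.update v x i := by
          funext y
          have := hρ y
          have := hne y
          have hy : v y = m.reg (ρ y) := rfl
          simp only [Function.comp]
          grind [Function.update_apply, Mem.reg_setReg]
        have hb' := ihb (Function.update ρ x (k + 1)) d (k + 2) m'' (by omega)
          (fun y => by have := hρ y; grind [Function.update_apply])
          (fun y => by have := hne y; grind [Function.update_apply])
          (fun r hr => by
            have := h0 r (by omega)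
            grind [Mem.reg_setReg]) hi hb
        rw [hc] at hb'
        refine Run.of_eq (Run.seq hb' (Run.atom _ _)) (Mem.ext rfl rfl rfl rfl (funext fun j => ?_))
        have := hS i
        grind [Mem.reg_setReg, Atom.run]
    · refine Run.loop_of n
        (fun i => (m.setReg (k + 1) (n - i)).setReg d (m.reg d + S n)) (fun _ => 1)
        rfl (Mem.ext rfl rfl rfl rfl (funext fun j => ?_)) rfl (fun i hi => ?_) (fun i hi =>
          Run.of_eq (Run.atom _ _) (Mem.ext rfl rfl rfl rfl (funext fun j => ?_)))
      · grind [Mem.reg_setReg]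
      · grind [Mem.reg_setReg]
      · grind [Mem.reg_setReg, Atom.run]
  | look s a iha =>
    intro ρ d k m hd hρ hne h0 hi hb
    have h0k := h0 k le_rfl
    have ha := iha ρ k (k + 1) m (by omega) (fun x => (hρ x).trans (by omega))
      (fun x => (hρ x).ne) (fun r hr => h0 r (by omega)) hi hb
    set n := a.eval w (m.reg ∘ ρ) with hn
    refine Run.seq ha (Run.seq (m' := m.scan w n) ?_ ?_)
    · refine Run.loop_of n (fun i => (m.setReg k (n - i)).scan w i) (fun _ => 1) ?_ ?_ rfl
        (fun i hi => ?_) (fun i hi => ?_)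
      · simp [Mem.scan, Mem.setReg, hi, hb, h0k]
      · simp [Mem.setReg_self _ _ h0k]
      · simp [Mem.scan, Mem.setReg]
      · have h := Run.atom (.shift : Atom I O) ((m.setReg k (n - (i + 1))).scan w i)
        rw [Mem.shift_scan] at h
        exact Run.congr_left h (by simp [Mem.scan, Mem.setReg])
    · refine Run.of_eq (t := 1 + (min n w.length + 1))
        (m' := Atom.rewind.run ((Atom.test s d).run (m.scan w n))) ?_ ?_
      · have h := Run.seq (Run.atom (.test s d) (m.scan w n)) (Run.atom .rewind _)
        have hc : (Atom.test s d).cost (m.scan w n) +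
            Atom.rewind.cost ((Atom.test s d).run (m.scan w n)) = 1 + (min n w.length + 1) := by
          change 1 + ((w.take n).reverse.length + 1) = _
          simp
        rwa [hc] at h
      · simp only [Atom.run, Mem.scan, Mem.setReg, eval, List.head?_drop, ← hn,
          List.reverse_reverse, List.take_append_drop]
        rw [← hi, ← hb]
  | count s =>
    intro ρ d k m hd hρ hne h0 hi hb
    refine Run.of_eq (t := (w.length + 1) + (w.length + 1))
      (m' := Atom.rewind.run ((Atom.count s d).run m)) ?_ ?_
    · have h := Run.seq (Run.atom (.count s d) m) (Run.atom .rewind _)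
      have hc : (Atom.count s d).cost m + Atom.rewind.cost ((Atom.count s d).run m) =
          (w.length + 1) + (w.length + 1) := by
        change (m.inp.length + 1) + ((m.inp.reverse ++ m.back).length + 1) = _
        simp [hi, hb]
      rwa [hc] at h
    · subst hi
      simp [Atom.run, Mem.setReg, eval, hb]

end RegMachine

namespace RegMachine

variable {I O : Type} [DecidableEq I]

/-! #### Word programs -/

namespace WordProg

/-- The word that is written. -/
def eval (w : List I) : WordProg I O → (ℕ → ℕ) → List O
  | emit o, _ => [o]
  | seq p q, v => p.eval w v ++ q.eval w v
  | rep x a p, v =>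
      (List.range (a.eval w v)).flatMap fun i => p.eval w (Function.update v x i)

/-- The loop program of a word program. The variable `x` is kept in the register `ρ x`, and the
registers from `k` on are free. -/
def cmd : WordProg I O → (ℕ → ℕ) → ℕ → Cmd I O
  | emit o, _, _ => .atom (.emit o)
  | seq p q, ρ, k => .seq (p.cmd ρ k) (q.cmd ρ k)
  | rep x a p, ρ, k =>
      .seq (a.cmd ρ k (k + 2)) (.seq
        (.loop k (.seq (p.cmd (Function.update ρ x (k + 1)) (k + 2)) (.atom (.inc (k + 1)))))
        (.loop (k + 1) (.atom .skip)))

/-- The running time of `WordProg.cmd`. -/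
def cost (w : List I) : WordProg I O → (ℕ → ℕ) → ℕ
  | emit _, _ => 1
  | seq p q, v => p.cost w v + q.cost w v
  | rep x a p, v => a.cost w v +
      ((1 + ∑ i ∈ Finset.range (a.eval w v), (1 + (p.cost w (Function.update v x i) + 1))) +
        (1 + ∑ _i ∈ Finset.range (a.eval w v), (1 + 1)))

end WordProg

/-- `WordProg.cmd` appends the word to the output and restores everything else. -/
theorem WordProg.run (w : List I) (p : WordProg I O) :
    ∀ (ρ : ℕ → ℕ) (k : ℕ) (m : Mem I O), (∀ x, ρ x < k) →
      (∀ r, k ≤ r → m.reg r = 0) → m.inp = w → m.back = [] →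
      Run (p.cmd ρ k) m { m with rev := (p.eval w (m.reg ∘ ρ)).reverse ++ m.rev }
        (p.cost w (m.reg ∘ ρ)) := by
  induction p with
  | emit o =>
    intro ρ k m hρ h0 hi hb
    exact Run.atom _ _
  | seq p q ihp ihq =>
    intro ρ k m hρ h0 hi hb
    refine Run.of_eq (Run.seq (ihp ρ k m hρ h0 hi hb) (ihq ρ k _ hρ h0 hi hb)) ?_
    simp [eval]
  | rep x a p ih =>
    intro ρ k m hρ h0 hi hb
    have h0k := h0 k le_rfl
    have h0k' := h0 (k + 1) (by omega)
    have ha := a.run w ρ k (k + 2) m (by omega) (fun x => (hρ x).trans (by omega))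
      (fun x => (hρ x).ne) (fun r hr => h0 r (by omega)) hi hb
    set v := m.reg ∘ ρ with hv
    set n := a.eval w v with hn
    let S : ℕ → List O := fun i =>
      (List.range i).flatMap fun j => p.eval w (Function.update v x j)
    have hS : ∀ i, S (i + 1) = S i ++ p.eval w (Function.update v x i) := fun i => by
      simp [S, List.range_succ]
    have hS0 : S 0 = [] := rfl
    have he : eval w (rep x a p) v = S n := rfl
    clear_value S
    let A : ℕ → Mem I O := fun i => { m with rev := (S i).reverse ++ m.rev }
    refine Run.seq ha (Run.seq (m' := (A n).setReg (k + 1) n) ?_ ?_)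
    · refine Run.loop_of n (fun i => ((A i).setReg k (n - i)).setReg (k + 1) i)
        (fun i => p.cost w (Function.update v x i) + 1)
        (Mem.ext rfl rfl
          (by rw [show (_ : Mem I O).rev = (S 0).reverse ++ m.rev from rfl, hS0]; rfl) rfl
          (funext fun j => ?_))
        (Mem.ext rfl rfl rfl rfl (funext fun j => ?_)) rfl (fun i hi => ?_) (fun i hin => ?_)
      · have : (A 0).reg = m.reg := rfl
        grind [Mem.reg_setReg]
      · have : (A n).reg = m.reg := rfl
        grind [Mem.reg_setReg]
      · have : (A i).reg = m.reg := rfl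
        grind [Mem.reg_setReg]
      · set m'' : Mem I O := (((A i).setReg k (n - i)).setReg (k + 1) i).setReg k (n - (i + 1))
          with hm''
        have hA : (A i).reg = m.reg := rfl
        have hA' : (A (i + 1)).reg = m.reg := rfl
        have hc : m''.reg ∘ (Function.update ρ x (k + 1)) = Function.update v x i := by
          funext y
          have := hρ y
          have hy : v y = m.reg (ρ y) := rfl
          simp only [Function.comp]
          grind [Function.update_apply, Mem.reg_setReg]
        have hb' := ih (Function.update ρ x (k + 1)) (k + 2) m''
          (fun y => by have := hρ y; grind [Function.update_apply])
          (fun r hr => by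
            have := h0 r (by omega)
            grind [Mem.reg_setReg]) hi hb
        rw [hc] at hb'
        refine Run.of_eq (Run.seq hb' (Run.atom _ _))
          (Mem.ext rfl rfl ?_ rfl (funext fun j => ?_))
        · change (p.eval w (Function.update v x i)).reverse ++ ((S i).reverse ++ m.rev) =
            (S (i + 1)).reverse ++ m.rev
          simp [hS]
        · change ((m''.setReg (k + 1) (m''.reg (k + 1) + 1))).reg j = _
          grind [Mem.reg_setReg]
    · have hA : (A n).reg = m.reg := rfl
      refine Run.loop_of n (fun i => (A n).setReg (k + 1) (n - i)) (fun _ => 1)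
        rfl (Mem.ext rfl rfl (by rw [he]; rfl) rfl (funext fun j => ?_)) rfl (fun i hi => ?_)
        (fun i hi => Run.of_eq (Run.atom _ _) (Mem.ext rfl rfl rfl rfl (funext fun j => ?_)))
      · change ((A n).setReg (k + 1) (n - n)).reg j = m.reg j
        grind [Mem.reg_setReg]
      · grind [Mem.reg_setReg]
      · grind [Mem.reg_setReg, Atom.run]

/-! #### Polynomial bounds -/

/-- `f` is bounded by a fixed power of any `M ≥ 2` that bounds the length of the input and the
values of the variables. -/
def PolyBdd (f : List I → (ℕ → ℕ) → ℕ) : Prop :=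
  ∃ c, ∀ w v M, 2 ≤ M → w.length ≤ M → (∀ x, v x ≤ M) → f w v ≤ M ^ c

namespace PolyBdd

variable {I : Type} {f g : List I → (ℕ → ℕ) → ℕ}

theorem mono (hg : PolyBdd g) (h : ∀ w v, f w v ≤ g w v) : PolyBdd f := by
  obtain ⟨c, hc⟩ := hg
  exact ⟨c, fun w v M h2 hw hv => (h w v).trans (hc w v M h2 hw hv)⟩

theorem const (n : ℕ) : PolyBdd fun (_ : List I) _ => n :=
  ⟨n, fun _ _ _ h2 _ _ => n.lt_two_pow_self.le.trans (Nat.pow_le_pow_left h2 n)⟩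

theorem var (x : ℕ) : PolyBdd fun (_ : List I) v => v x :=
  ⟨1, fun _ _ _ _ _ hv => by simpa using hv x⟩

theorem length : PolyBdd fun (w : List I) _ => w.length :=
  ⟨1, fun _ _ _ _ hw _ => by simpa using hw⟩

theorem add (hf : PolyBdd f) (hg : PolyBdd g) : PolyBdd fun w v => f w v + g w v := by
  obtain ⟨c, hc⟩ := hf
  obtain ⟨d, hd⟩ := hg
  refine ⟨max c d + 1, fun w v M h2 hw hv => ?_⟩
  have h1 := (hc w v M h2 hw hv).trans (Nat.pow_le_pow_right (by omega) (le_max_left c d))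
  have h3 := (hd w v M h2 hw hv).trans (Nat.pow_le_pow_right (by omega) (le_max_right c d))
  rw [pow_succ]
  nlinarith

theorem mul (hf : PolyBdd f) (hg : PolyBdd g) : PolyBdd fun w v => f w v * g w v := by
  obtain ⟨c, hc⟩ := hf
  obtain ⟨d, hd⟩ := hg
  refine ⟨c + d, fun w v M h2 hw hv => ?_⟩
  rw [pow_add]
  exact Nat.mul_le_mul (hc w v M h2 hw hv) (hd w v M h2 hw hv)

theorem sum (x : ℕ) (hf : PolyBdd f) (hg : PolyBdd g) :
    PolyBdd fun w v => ∑ i ∈ Finset.range (f w v), g w (Function.update v x i) := by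
  obtain ⟨c, hc⟩ := hf
  obtain ⟨d, hd⟩ := hg
  -- values of the bound variable are below `M ^ c`, so all variables are at most `M ^ (c + 1)`
  refine ⟨c + (c + 1) * d, fun w v M h2 hw hv => ?_⟩
  have hM : M ≤ M ^ (c + 1) := Nat.le_self_pow (by omega) M
  have hcM := hc w v M h2 hw hv
  have h1 : ∀ i ∈ Finset.range (f w v), g w (Function.update v x i) ≤ (M ^ (c + 1)) ^ d := by
    intro i hi
    refine hd _ _ _ (h2.trans hM) (hw.trans hM) fun y => ?_
    rcases eq_or_ne y x with rfl | hy
    · rw [Function.update_self]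
      exact ((Finset.mem_range.1 hi).le.trans hcM).trans
        (Nat.pow_le_pow_right (by omega) (Nat.le_succ c))
    · rw [Function.update_of_ne hy]
      exact (hv y).trans hM
  refine (Finset.sum_le_card_nsmul _ _ _ h1).trans ?_
  rw [Finset.card_range, smul_eq_mul, pow_add M c ((c + 1) * d), pow_mul M (c + 1)]
  exact Nat.mul_le_mul_right _ hcM

end PolyBdd

theorem Expr.polyBdd_eval (e : Expr I) : PolyBdd fun w v => e.eval w v := by
  induction e with
  | var x => exact PolyBdd.var x
  | one => exact PolyBdd.const 1
  | add a b iha ihb => exact iha.add ihb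
  | sub a b iha ihb => exact iha.mono fun w v => Nat.sub_le _ _
  | mul a b iha ihb => exact iha.mul ihb
  | sum x a b iha ihb => exact PolyBdd.sum x iha ihb
  | look s a iha => exact (PolyBdd.const 1).mono fun w v => by simp only [eval]; split_ifs <;> simp
  | count s => exact PolyBdd.length.mono fun w v => List.count_le_length

theorem Expr.polyBdd_cost (e : Expr I) : PolyBdd fun w v => e.cost w v := by
  have one := PolyBdd.const (I := I) 1
  induction e with
  | var x =>
    exact (one.add (PolyBdd.sum 0 (PolyBdd.var x) (PolyBdd.const (1 + (1 + 1))))).add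
      (one.add (PolyBdd.sum 0 (PolyBdd.var x) (PolyBdd.const (1 + 1))))
  | one => exact one
  | add a b iha ihb => exact iha.add ihb
  | sub a b iha ihb =>
    exact iha.add (ihb.add ((one.add (PolyBdd.sum 0 b.polyBdd_eval (PolyBdd.const (1 + 1)))).add
      (one.add (PolyBdd.sum 0 (a.sub b).polyBdd_eval (PolyBdd.const (1 + 1))))))
  | mul a b iha ihb =>
    exact iha.add ((one.add (a.polyBdd_eval.mul (one.add ihb))).mono fun w v => by simp)
  | sum x a b iha ihb =>
    exact iha.add ((one.add (PolyBdd.sum x a.polyBdd_eval (one.add (ihb.add one)))).add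
      (one.add (PolyBdd.sum 0 a.polyBdd_eval (PolyBdd.const (1 + 1)))))
  | look s a iha =>
    exact iha.add ((one.add (PolyBdd.sum 0 a.polyBdd_eval (PolyBdd.const (1 + 1)))).add
      (one.add ((PolyBdd.length.mono fun w v => min_le_right _ _).add one)))
  | count s => exact (PolyBdd.length.add one).add (PolyBdd.length.add one)

theorem WordProg.polyBdd_cost (p : WordProg I O) : PolyBdd fun w v => p.cost w v := by
  have one := PolyBdd.const (I := I) 1
  induction p with
  | emit o => exact one
  | seq p q ihp ihq => exact ihp.add ihq
  | rep x a p ih =>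
    exact a.polyBdd_cost.add ((one.add (PolyBdd.sum x a.polyBdd_eval (one.add (ih.add one)))).add
      (one.add (PolyBdd.sum 0 a.polyBdd_eval (PolyBdd.const (1 + 1)))))

theorem WordProg.polyBdd_length (p : WordProg I O) : PolyBdd fun w v => (p.eval w v).length := by
  induction p with
  | emit o => exact PolyBdd.const 1
  | seq p q ihp ihq => exact (ihp.add ihq).mono fun w v => (List.length_append).le
  | rep x a p ih =>
    refine (PolyBdd.sum x a.polyBdd_eval ih).mono fun w v => ?_
    rw [eval, List.length_flatMap]
    exact le_rfl

/-- A function whose coded values are written by a word program from the coded arguments is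
computable in polynomial time. -/
theorem polyTime_of_wordProg [Inhabited I] [Inhabited O] [Fintype I] [Fintype O] {α β : Type}
    {ea : α → List I} {eb : β → List O} {f : α → β} (p : WordProg I O)
    (h : ∀ a, p.eval (ea a) (fun _ => 0) = eb (f a)) :
    Nonempty (TM2ComputableInPolyTime ea eb f) := by
  obtain ⟨c, hc⟩ := p.polyBdd_cost.add (((PolyBdd.length (I := I)).add (PolyBdd.const 1)).add
    (p.polyBdd_length.add (PolyBdd.const 1)))
  refine polyTime_of_run (.seq (p.cmd (fun _ => 0) 1) (.seq (.atom .drain) (.atom .flush)))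
    ((Polynomial.X + 2) ^ c) fun a => ⟨p.cost (ea a) (fun _ => 0) +
      (((ea a).length + 1) + ((p.eval (ea a) (fun _ => 0)).length + 1)), ?_, ?_⟩
  · have := hc (ea a) (fun _ => 0) ((ea a).length + 2) (by omega) (by omega) (fun _ => by omega)
    simpa using this
  · have h1 := p.run (ea a) (fun _ => 0) 1 (Mem.ofInput (ea a)) (fun _ => one_pos)
      (fun _ _ => rfl) rfl rfl
    refine Run.of_eq (m' := Atom.flush.run (Atom.drain.run { (Mem.ofInput (ea a) : Mem I O) with
      rev := (p.eval (ea a) (fun _ => 0)).reverse ++ [] })) ?_ ?_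
    · have hl : ((p.eval (ea a) (fun _ => 0)).reverse ++ []).length =
          (p.eval (ea a) (fun _ => 0)).length := by simp
      rw [← hl]
      exact Run.seq h1 (Run.seq (Run.atom .drain _) (Run.atom .flush _))
    · simp [Atom.run, Mem.ofInput, Mem.ofOutput, ← h]

end RegMachine

/-! ### Squares -/

theorem SimpleGraph.square_adj_iff {V : Type*} (G : SimpleGraph V) {x y : V} :
    G.square.Adj x y ↔ x ≠ y ∧ (G.Adj x y ∨ ∃ z, G.Adj x z ∧ G.Adj z y) := by
  refine and_congr_right fun hne => ⟨fun h => ?_, ?_⟩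
  · obtain ⟨p, hp⟩ := G.exists_walk_of_edist_ne_top (ne_top_of_le_ne_top (by decide) h)
    rw [← hp] at h
    have h2 : p.length ≤ 2 := by exact_mod_cast h
    match p, h2 with
    | .nil, _ => exact (hne rfl).elim
    | .cons h .nil, _ => exact Or.inl h
    | .cons h (.cons h' .nil), _ => exact Or.inr ⟨_, h, h'⟩
    | .cons _ (.cons _ (.cons _ p)), h2 => simp at h2
  · rintro (h | ⟨z, h, h'⟩)
    · exact (SimpleGraph.edist_le h.toWalk).trans (by norm_num)
    · exact (SimpleGraph.edist_le (.cons h (.cons h' .nil))).trans (by norm_num)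

/-- Being squco is invariant under isomorphism. -/
theorem SimpleGraph.Iso.isSquco_iff {V W : Type*} {G : SimpleGraph V} {G' : SimpleGraph W}
    (e : G ≃g G') : G.IsSquco ↔ G'.IsSquco := by
  have hs : Nonempty (G.square ≃g G'.square) := by
    refine ⟨⟨e.toEquiv, fun {x y} => ?_⟩⟩
    simp only [SimpleGraph.square_adj_iff]
    have h : ∀ a b, G'.Adj (e.toEquiv a) (e.toEquiv b) ↔ G.Adj a b := fun a b => e.map_adj_iff
    rw [h, e.toEquiv.injective.ne_iff, ← e.toEquiv.exists_congr_right]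
    simp only [h]
  have hc : Nonempty (Gᶜ ≃g G'ᶜ) := by
    refine ⟨⟨e.toEquiv, fun {x y} => ?_⟩⟩
    simp only [SimpleGraph.compl_adj]
    have h : ∀ a b, G'.Adj (e.toEquiv a) (e.toEquiv b) ↔ G.Adj a b := fun a b => e.map_adj_iff
    rw [h, e.toEquiv.injective.ne_iff]
  obtain ⟨s⟩ := hs
  obtain ⟨c⟩ := hc
  exact ⟨fun ⟨f⟩ => ⟨(s.symm.trans f).trans c⟩, fun ⟨f⟩ => ⟨(s.trans f).trans c.symm⟩⟩

/-! ### Isomorphisms of bipartite graphs -/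

namespace BipGraph

variable {A B A' B' : Type*}

/-- An isomorphism of bipartite graphs that maps left parts to left parts. -/
structure Iso (K : BipGraph A B) (L : BipGraph A' B') where
  /-- the bijection of the left parts -/
  left : A ≃ A'
  /-- the bijection of the right parts -/
  right : B ≃ B'
  /-- edges correspond to edges -/
  adj : ∀ a b, L.Adj (left a) (right b) ↔ K.Adj a b

namespace Iso

variable {A₁ B₁ A₂ B₂ : Type*} {K : BipGraph A B} {L : BipGraph A' B'} {K₁ : BipGraph A₁ B₁}
  {K₂ : BipGraph A₂ B₂}

/-- The inverse isomorphism. -/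
def symm (e : Iso K L) : Iso L K where
  left := e.left.symm
  right := e.right.symm
  adj a b := by rw [← e.adj]; simp

/-- An isomorphism is also an isomorphism of the bipartite complements. -/
def compl (e : Iso K L) : Iso K.compl L.compl where
  left := e.left
  right := e.right
  adj a b := not_congr (e.adj a b)

/-- The isomorphism of the underlying graphs. -/
def toGraph (e : Iso K L) : K.toGraph ≃g L.toGraph where
  toEquiv := Equiv.sumCongr e.left e.right
  map_rel_iff' := by
    rintro (a | b) (a' | b')
    · exact Iff.rfl
    · exact e.adj a b'
    · exact e.adj a' b
    · exact Iff.rfl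

/-- `H` respects isomorphisms. -/
def mapH (e : Iso K L) (f : Iso K₁ K₂) : Iso (BipGraph.H K K₁) (BipGraph.H L K₂) where
  left := Equiv.sumCongr e.left (Equiv.sumCongr f.left (Equiv.refl _))
  right := Equiv.sumCongr e.right (Equiv.sumCongr f.right (Equiv.refl _))
  adj := by
    rintro (a | a | i) (b | b | j)
    · exact e.adj a b
    · exact Iff.rfl
    · exact Iff.rfl
    · exact Iff.rfl
    · exact f.adj a b
    · exact Iff.rfl
    · exact Iff.rfl
    · exact Iff.rfl
    · exact Iff.rfl

/-- The bipartite complement of `H(J, J')` is `H` of the complements of `J'` and `J`: the two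
graphs and the vertices `d₁` and `d₂` change places. -/
def complH (J : BipGraph A B) (J' : BipGraph A' B') :
    Iso (BipGraph.H J J').compl (BipGraph.H J'.compl J.compl) where
  left := (Equiv.sumAssoc _ _ _).symm.trans
    ((Equiv.sumCongr (Equiv.sumComm _ _) (Equiv.refl _)).trans (Equiv.sumAssoc _ _ _))
  right := (Equiv.sumAssoc _ _ _).symm.trans
    ((Equiv.sumCongr (Equiv.sumComm _ _) (Equiv.swap 0 1)).trans (Equiv.sumAssoc _ _ _))
  adj := by
    rintro (a | a | i) (b | b | j)
    case inr.inr.inr.inr =>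
      change i = Equiv.swap 0 1 j ↔ ¬ i = j
      revert i j
      decide
    all_goals simp [BipGraph.H, BipGraph.compl]

end Iso

@[simp] theorem compl_compl (K : BipGraph A B) : K.compl.compl = K := by
  simp [compl]

/-! ### Bipartite graphs of diameter at most three -/

/-- Any two vertices in the same part have a common neighbour. -/
def Close (K : BipGraph A B) : Prop :=
  (∀ a a', ∃ b, K.Adj a b ∧ K.Adj a' b) ∧ ∀ b b', ∃ a, K.Adj a b ∧ K.Adj a b'

/-- In `H(J, J')` the vertices of `D` and of `C` are common neighbours within `A` and within `B'`,
and vertices of `A'` and `B` are common neighbours within `B` and within `A'`. A vertex of `A` and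
one of `A'` share a neighbour in `B`, as the first one is not isolated in `J`; a vertex `cᵢ` shares
`dᵢ` with `A`, and shares with `A'` a neighbour in `B'` of the second vertex. The right part is
similar. -/
theorem close_H {J : BipGraph A B} {J' : BipGraph A' B'} [Nonempty A] [Nonempty A']
    (h : J.toGraph.NoIsolated) (h' : J'.toGraph.NoIsolated) : (H J J').Close := by
  have hl : ∀ a, ∃ b, J.Adj a b := fun a => by
    obtain ⟨w | w, hw⟩ := h (.inl a)
    exacts [hw.elim, ⟨w, hw⟩]
  have hr : ∀ b, ∃ a, J.Adj a b := fun b => by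
    obtain ⟨w | w, hw⟩ := h (.inr b)
    exacts [⟨w, hw⟩, hw.elim]
  have hl' : ∀ a, ∃ b, J'.Adj a b := fun a => by
    obtain ⟨w | w, hw⟩ := h' (.inl a)
    exacts [hw.elim, ⟨w, hw⟩]
  have hr' : ∀ b, ∃ a, J'.Adj a b := fun b => by
    obtain ⟨w | w, hw⟩ := h' (.inr b)
    exacts [⟨w, hw⟩, hw.elim]
  obtain ⟨a₀⟩ := ‹Nonempty A›
  obtain ⟨a₀'⟩ := ‹Nonempty A'›
  obtain ⟨b₀, -⟩ := hl a₀
  obtain ⟨b₀', -⟩ := hl' a₀'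
  refine ⟨?_, ?_⟩
  · rintro (a | a | i) (c | c | j)
    · exact ⟨.inr (.inr 0), trivial, trivial⟩
    · obtain ⟨b, hb⟩ := hl a
      exact ⟨.inl b, hb, trivial⟩
    · exact ⟨.inr (.inr j), trivial, rfl⟩
    · obtain ⟨b, hb⟩ := hl c
      exact ⟨.inl b, trivial, hb⟩
    · exact ⟨.inl b₀, trivial, trivial⟩
    · obtain ⟨b, hb⟩ := hl' a
      exact ⟨.inr (.inl b), hb, trivial⟩
    · exact ⟨.inr (.inr i), rfl, trivial⟩
    · obtain ⟨b, hb⟩ := hl' c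
      exact ⟨.inr (.inl b), trivial, hb⟩
    · exact ⟨.inr (.inl b₀'), trivial, trivial⟩
  · rintro (b | b | i) (c | c | j)
    · exact ⟨.inr (.inl a₀'), trivial, trivial⟩
    · obtain ⟨a, ha⟩ := hr' c
      exact ⟨.inr (.inl a), trivial, ha⟩
    · obtain ⟨a, ha⟩ := hr b
      exact ⟨.inl a, ha, trivial⟩
    · obtain ⟨a, ha⟩ := hr' b
      exact ⟨.inr (.inl a), ha, trivial⟩
    · exact ⟨.inr (.inr 0), trivial, trivial⟩
    · exact ⟨.inr (.inr j), trivial, rfl⟩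
    · obtain ⟨a, ha⟩ := hr c
      exact ⟨.inl a, trivial, ha⟩
    · exact ⟨.inr (.inr i), rfl, trivial⟩
    · exact ⟨.inl a₀, trivial, trivial⟩

/-- All distances in the same part are two, and vertices of different parts are at distance one or
at least three. -/
theorem Close.square_eq {K : BipGraph A B} (h : K.Close) :
    K.toGraph.square = K.compl.toGraphᶜ := by
  ext x y
  rw [SimpleGraph.square_adj_iff, SimpleGraph.compl_adj]
  refine and_congr_right fun _ => ?_
  rcases x with a | b <;> rcases y with a' | b'
  · obtain ⟨b, h1, h2⟩ := h.1 a a'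
    exact iff_of_true (Or.inr ⟨.inr b, h1, h2⟩) id
  · simp [toGraph, compl]
  · simp [toGraph, compl]
  · obtain ⟨a, h1, h2⟩ := h.2 b b'
    exact iff_of_true (Or.inr ⟨.inl a, h1, h2⟩) id

/-- The graph is squco if and only if it is isomorphic to its bipartite complement, not necessarily
with the same bipartition. -/
theorem Close.isSquco_iff {K : BipGraph A B} (h : K.Close) :
    K.toGraph.IsSquco ↔ Nonempty (K.toGraph ≃g K.compl.toGraph) := by
  have key : ∀ f : A ⊕ B ≃ A ⊕ B,
      (∀ x y, K.toGraphᶜ.Adj (f x) (f y) ↔ K.compl.toGraphᶜ.Adj x y) ↔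
        ∀ x y, K.toGraph.Adj (f x) (f y) ↔ K.compl.toGraph.Adj x y := by
    intro f
    refine forall₂_congr fun x y => ?_
    rw [SimpleGraph.compl_adj, SimpleGraph.compl_adj, f.injective.ne_iff]
    by_cases hxy : x = y
    · subst hxy; simp
    · simp only [ne_eq, hxy, not_false_eq_true, true_and]; exact not_iff_not
  rw [SimpleGraph.IsSquco, h.square_eq]
  refine ⟨fun ⟨f⟩ => ?_, fun ⟨f⟩ => ?_⟩
  · have := (key f.toEquiv).1 fun x y => f.map_rel_iff
    exact ⟨SimpleGraph.Iso.symm ⟨f.toEquiv, fun {x y} => this x y⟩⟩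
  · have := (key f.symm.toEquiv).2 fun x y => f.symm.map_rel_iff
    exact ⟨⟨f.symm.toEquiv, fun {x y} => this x y⟩⟩

theorem toGraph_common_left {K : BipGraph A B} {a : A} {b : B} {z : A ⊕ B}
    (h : K.toGraph.Adj (.inl a) z) (h' : K.toGraph.Adj (.inr b) z) : False := by
  rcases z with z | z
  exacts [h, h']

/-- An isomorphism between bipartite graphs respects the bipartitions if any two vertices in the
same part of the second graph have a common neighbour and its left part is too small to receive the
right part of the first one. -/
theorem Close.exists_iso [Finite A'] [Nonempty A]
    {K : BipGraph A B} {L : BipGraph A' B'} (hL : L.Close)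
    (hA : Nat.card A' < Nat.card B)
    (e : K.toGraph ≃g L.toGraph) : Nonempty (Iso K L) := by
  -- a left and a right vertex have no common neighbour, so each part goes into one part
  have hsep : ∀ a b, ¬ ((∃ a₁ a₂, e (.inl a) = .inl a₁ ∧ e (.inr b) = .inl a₂) ∨
      ∃ b₁ b₂, e (.inl a) = .inr b₁ ∧ e (.inr b) = .inr b₂) := by
    have hcom : ∀ a b z, L.toGraph.Adj (e (.inl a)) z → L.toGraph.Adj (e (.inr b)) z → False := by
      intro a b z h1 h2
      rw [← e.apply_symm_apply z] at h1 h2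
      exact toGraph_common_left (e.map_adj_iff.1 h1) (e.map_adj_iff.1 h2)
    rintro a b (⟨a₁, a₂, h1, h2⟩ | ⟨b₁, b₂, h1, h2⟩)
    · obtain ⟨z, hz, hz'⟩ := hL.1 a₁ a₂
      exact hcom a b (.inr z) (h1 ▸ hz) (h2 ▸ hz')
    · obtain ⟨z, hz, hz'⟩ := hL.2 b₁ b₂
      exact hcom a b (.inl z) (h1 ▸ hz) (h2 ▸ hz')
  have hleft : ∀ a, ∃ a', e (.inl a) = .inl a' := by
    intro a
    rcases h : e (.inl a) with a' | b'
    · exact ⟨a', rfl⟩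
    · exfalso
      have hr : ∀ b, ∃ a', e (.inr b) = .inl a' := fun b => by
        rcases h' : e (.inr b) with a' | b''
        · exact ⟨a', rfl⟩
        · exact (hsep a b (Or.inr ⟨_, _, h, h'⟩)).elim
      choose g hg using hr
      have hinj : Function.Injective g := fun b c hbc =>
        Sum.inr_injective (e.injective (by rw [hg, hg, hbc]))
      exact absurd (Nat.card_le_card_of_injective g hinj) (not_le.2 hA)
  have hright : ∀ b, ∃ b', e (.inr b) = .inr b' := by
    intro b
    obtain ⟨a⟩ := ‹Nonempty A›
    obtain ⟨a', ha'⟩ := hleft a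
    rcases h' : e (.inr b) with a'' | b'
    · exact (hsep a b (Or.inl ⟨_, _, ha', h'⟩)).elim
    · exact ⟨b', rfl⟩
  choose f hf using hleft
  choose g hg using hright
  have hfb : Function.Bijective f := by
    refine ⟨fun a c h => Sum.inl_injective (e.injective (by rw [hf, hf, h])), fun a' => ?_⟩
    rcases h : e.symm (.inl a') with a | b
    · refine ⟨a, Sum.inl_injective (β := B') ?_⟩
      rw [← hf, ← h, e.apply_symm_apply]
    · have : e (.inr b) = .inl a' := by rw [← h, e.apply_symm_apply]
      rw [hg] at this
      cases this
  have hgb : Function.Bijective g := by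
    refine ⟨fun a c h => Sum.inr_injective (e.injective (by rw [hg, hg, h])), fun b' => ?_⟩
    rcases h : e.symm (.inr b') with a | b
    · have : e (.inl a) = .inr b' := by rw [← h, e.apply_symm_apply]
      rw [hf] at this
      cases this
    · refine ⟨b, Sum.inr_injective (α := A') ?_⟩
      rw [← hg, ← h, e.apply_symm_apply]
  refine ⟨⟨Equiv.ofBijective f hfb, Equiv.ofBijective g hgb, fun a b => ?_⟩⟩
  have := e.map_adj_iff (v := .inl a) (w := .inr b)
  rw [hf, hg] at this
  exact this

end BipGraph

/-! ### Incidence graphs -/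

namespace SimpleGraph

variable {V W : Type*}

/-- Isomorphic graphs have isomorphic incidence graphs. -/
def Iso.incidence {G : SimpleGraph V} {G' : SimpleGraph W} (e : G ≃g G') :
    BipGraph.Iso G.incidence G'.incidence where
  left := e.toEquiv
  right := e.mapEdgeSet
  adj v x := by
    obtain ⟨x, hx⟩ := x
    change e v ∈ Sym2.map e x ↔ v ∈ x
    rw [Sym2.mem_map]
    exact ⟨fun ⟨w, hw, h⟩ => e.injective h ▸ hw, fun h => ⟨v, h, rfl⟩⟩

theorem adj_of_incidence_iso {G : SimpleGraph V} {G' : SimpleGraph W}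
    (e : BipGraph.Iso G.incidence G'.incidence) {u v : V} (h : G.Adj u v) :
    G'.Adj (e.left u) (e.left v) := by
  let x : G.edgeSet := ⟨s(u, v), h⟩
  have hu : e.left u ∈ (e.right x).1 := (e.adj u x).2 (Sym2.mem_mk_left u v)
  have hv : e.left v ∈ (e.right x).1 := (e.adj v x).2 (Sym2.mem_mk_right u v)
  have : (e.right x).1 = s(e.left u, e.left v) :=
    (Sym2.mem_and_mem_iff (e.left.injective.ne h.ne)).1 ⟨hu, hv⟩
  have hx := (e.right x).2
  rwa [this] at hx

/-- A graph is determined by its incidence graph. -/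
def isoOfIncidence {G : SimpleGraph V} {G' : SimpleGraph W}
    (e : BipGraph.Iso G.incidence G'.incidence) : G ≃g G' where
  toEquiv := e.left
  map_rel_iff' {u v} := ⟨fun h => by simpa [BipGraph.Iso.symm] using adj_of_incidence_iso e.symm h,
    adj_of_incidence_iso e⟩

theorem card_incident (G : SimpleGraph V) (x : G.edgeSet) :
    Nat.card {v // G.incidence.Adj v x} = 2 := by
  obtain ⟨x, hx⟩ := x
  induction x with
  | _ u v =>
    have : {w | w ∈ s(u, v)} = {u, v} := by ext; simp
    change Set.ncard {w | w ∈ s(u, v)} = 2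
    rw [this]
    exact Set.ncard_pair (G.ne_of_adj hx)

theorem card_not_incident [Finite V] (G : SimpleGraph V) (x : G.edgeSet) :
    Nat.card {v // G.incidence.compl.Adj v x} + 2 = Nat.card V := by
  classical
  have h := Nat.card_congr (Equiv.sumCompl fun v => G.incidence.Adj v x)
  rw [Nat.card_sum, card_incident] at h
  rw [← h, add_comm]
  rfl

end SimpleGraph

/-! ### The gadget determines the graph -/

theorem card_subtype_sum₃ {A B C : Type*} [Finite A] [Finite B] [Finite C]
    (p : A ⊕ B ⊕ C → Prop) :
    Nat.card {x // p x} = Nat.card {a // p (.inl a)} + (Nat.card {b // p (.inr (.inl b))} +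
      Nat.card {c // p (.inr (.inr c))}) := by
  rw [Nat.card_congr (Equiv.subtypeSum (p := p)), Nat.card_sum,
    Nat.card_congr (Equiv.subtypeSum (p := fun x : B ⊕ C => p (.inr x))), Nat.card_sum]

theorem card_subtype_true {A : Type*} {p : A → Prop} (h : ∀ a, p a) :
    Nat.card {a // p a} = Nat.card A :=
  Nat.card_congr (Equiv.subtypeUnivEquiv h)

theorem card_subtype_false {A : Type*} {p : A → Prop} (h : ∀ a, ¬ p a) :
    Nat.card {a // p a} = 0 :=
  have : IsEmpty {a // p a} := ⟨fun a => h _ a.2⟩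
  Nat.card_of_isEmpty

namespace BipGraph

theorem Iso.card_eq {A B A' B' : Type*} {K : BipGraph A B} {L : BipGraph A' B'} (e : Iso K L)
    (b : B) : Nat.card {a // L.Adj a (e.right b)} = Nat.card {a // K.Adj a b} :=
  (Nat.card_congr (e.left.subtypeEquiv fun a => (e.adj a b).symm)).symm

variable {V W V' W' : Type*} [Finite V] [Finite W] {G : SimpleGraph V} {G' : SimpleGraph W}

theorem card_H_edge_left (x : G.edgeSet) :
    Nat.card {a // (H G.incidence G'.incidence.compl).Adj a (.inl x)} = Nat.card W + 2 := by
  rw [card_subtype_sum₃]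
  have h1 : Nat.card {v // (H G.incidence G'.incidence.compl).Adj (.inl v) (.inl x)} = 2 :=
    G.card_incident x
  have h2 : Nat.card {v // (H G.incidence G'.incidence.compl).Adj (.inr (.inl v)) (.inl x)} =
    Nat.card W := card_subtype_true fun _ => trivial
  have h3 : Nat.card {c // (H G.incidence G'.incidence.compl).Adj (.inr (.inr c)) (.inl x)} = 0 :=
    card_subtype_false fun _ => id
  omega

theorem card_H_edge_right (x : G'.edgeSet) :
    Nat.card {a // (H G.incidence G'.incidence.compl).Adj a (.inr (.inl x))} = Nat.card W := by
  rw [card_subtype_sum₃]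
  have h1 : Nat.card {v // (H G.incidence G'.incidence.compl).Adj (.inr (.inl v)) (.inr (.inl x))}
      + 2 = Nat.card W := G'.card_not_incident x
  have h2 : Nat.card {v // (H G.incidence G'.incidence.compl).Adj (.inl v) (.inr (.inl x))} = 0 :=
    card_subtype_false fun _ => id
  have h3 : Nat.card {c // (H G.incidence G'.incidence.compl).Adj (.inr (.inr c)) (.inr (.inl x))}
      = Nat.card (Fin 2) := card_subtype_true fun _ => trivial
  rw [Nat.card_fin] at h3
  omega

theorem card_H_d (j : Fin 2) :
    Nat.card {a // (H G.incidence G'.incidence.compl).Adj a (.inr (.inr j))} = Nat.card V + 1 := by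
  rw [card_subtype_sum₃]
  have h1 : Nat.card {c // (H G.incidence G'.incidence.compl).Adj (.inr (.inr c)) (.inr (.inr j))}
      = 1 := by
    have : Unique {c // (H G.incidence G'.incidence.compl).Adj (.inr (.inr c)) (.inr (.inr j))} :=
      ⟨⟨⟨j, rfl⟩⟩, fun c => Subtype.ext c.2⟩
    exact Nat.card_unique
  have h2 : Nat.card {v // (H G.incidence G'.incidence.compl).Adj (.inl v) (.inr (.inr j))} =
    Nat.card V := card_subtype_true fun _ => trivial
  have h3 : Nat.card {v // (H G.incidence G'.incidence.compl).Adj (.inr (.inl v)) (.inr (.inr j))}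
      = 0 := card_subtype_false fun _ => id
  omega

variable [Finite V'] [Finite W'] {F : SimpleGraph V'} {F' : SimpleGraph W'}

/-- The degrees `|V| + 2`, `|V|` and `|V| + 1` distinguish the three kinds of right vertices. -/
theorem Iso.exists_right (hVW : Nat.card V = Nat.card W)
    (hV : Nat.card V = Nat.card V') (hW : Nat.card W = Nat.card W')
    (e : Iso (H G.incidence G'.incidence.compl) (H F.incidence F'.incidence.compl)) :
    (∀ x, ∃ y, e.right (.inl x) = .inl y) ∧ ∀ j, ∃ k, e.right (.inr (.inr j)) = .inr (.inr k) := by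
  refine ⟨fun x => ?_, fun j => ?_⟩
  · have h := e.card_eq (.inl x)
    rw [card_H_edge_left] at h
    rcases hx : e.right (.inl x) with y | y | k <;> rw [hx] at h
    · exact ⟨y, rfl⟩
    · rw [card_H_edge_right] at h; omega
    · rw [card_H_d] at h; omega
  · have h := e.card_eq (.inr (.inr j))
    rw [card_H_d] at h
    rcases hx : e.right (.inr (.inr j)) with y | y | k <;> rw [hx] at h
    · rw [card_H_edge_left] at h; omega
    · rw [card_H_edge_right] at h; omega
    · exact ⟨k, rfl⟩

/-- The vertices of the first graph are the left vertices that are adjacent to both `d₁` and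
`d₂`. -/
theorem Iso.exists_left (hVW : Nat.card V = Nat.card W)
    (hV : Nat.card V = Nat.card V') (hW : Nat.card W = Nat.card W')
    (e : Iso (H G.incidence G'.incidence.compl) (H F.incidence F'.incidence.compl)) (v : V) :
    ∃ w, e.left (.inl v) = .inl w := by
  have hd : ∀ k : Fin 2, (H F.incidence F'.incidence.compl).Adj (e.left (.inl v))
      (.inr (.inr k)) := by
    intro k
    obtain ⟨j, hj⟩ := (e.symm.exists_right (by omega) hV.symm hW.symm).2 k
    have : e.right (.inr (.inr j)) = .inr (.inr k) := by
      rw [← hj]; exact e.right.apply_symm_apply _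
    rw [← this]
    exact (e.adj _ _).2 trivial
  rcases hx : e.left (.inl v) with w | w | i
  · exact ⟨w, rfl⟩
  · rw [hx] at hd
    exact (hd 0).elim
  · rw [hx] at hd
    have h0 : i = 0 := hd 0
    have h1 : i = 1 := hd 1
    omega

/-- By `Iso.exists_left` and `Iso.exists_right` an isomorphism of gadgets restricts to an
isomorphism of the incidence graphs of the two first graphs. -/
theorem Iso.graphIso_of_H (hVW : Nat.card V = Nat.card W)
    (hV : Nat.card V = Nat.card V') (hW : Nat.card W = Nat.card W')
    (e : Iso (H G.incidence G'.incidence.compl) (H F.incidence F'.incidence.compl)) :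
    Nonempty (G ≃g F) := by
  have hl := e.exists_left hVW hV hW
  have hl' := e.symm.exists_left (by omega) hV.symm hW.symm
  have hr := (e.exists_right hVW hV hW).1
  have hr' := (e.symm.exists_right (by omega) hV.symm hW.symm).1
  choose f hf using hl
  choose f' hf' using hl'
  choose g hg using hr
  choose g' hg' using hr'
  have hff : ∀ v, f' (f v) = v := fun v => Sum.inl_injective (β := W ⊕ Fin 2) (by
    rw [← hf', ← hf]; exact e.left.symm_apply_apply _)
  have hff' : ∀ v, f (f' v) = v := fun v => Sum.inl_injective (β := W' ⊕ Fin 2) (by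
    rw [← hf, ← hf']; exact e.left.apply_symm_apply _)
  have hgg : ∀ v, g' (g v) = v := fun v => Sum.inl_injective (β := G'.edgeSet ⊕ Fin 2) (by
    rw [← hg', ← hg]; exact e.right.symm_apply_apply _)
  have hgg' : ∀ v, g (g' v) = v := fun v => Sum.inl_injective (β := F'.edgeSet ⊕ Fin 2) (by
    rw [← hg, ← hg']; exact e.right.apply_symm_apply _)
  refine ⟨SimpleGraph.isoOfIncidence ⟨⟨f, f', hff, hff'⟩, ⟨g, g', hgg, hgg'⟩, fun v x => ?_⟩⟩
  have h := e.adj (.inl v) (.inl x)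
  rw [hf, hg] at h
  exact h

end BipGraph

section Gadget

variable {V₁ V₂ : Type*} {G₁ : SimpleGraph V₁} {G₂ : SimpleGraph V₂}

/-- The bipartite complement of the gadget is the gadget of the two graphs in reverse order. -/
def gadgetComplIso (G₁ : SimpleGraph V₁) (G₂ : SimpleGraph V₂) :
    BipGraph.Iso (BipGraph.H G₁.incidence G₂.incidence.compl).compl
      (BipGraph.H G₂.incidence G₁.incidence.compl) := by
  have e := BipGraph.Iso.complH G₁.incidence G₂.incidence.compl
  rwa [BipGraph.compl_compl] at e

/-- The gadget of `G₁` and `G₂` is isomorphic to the gadget of `G₂` and `G₁`, which is its bipartite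
complement. -/
theorem isSquco_gadget_of_iso [Nonempty V₁] (h₁ : G₁.incidence.toGraph.NoIsolated)
    (h₂ : G₂.incidence.compl.toGraph.NoIsolated) (e : G₁ ≃g G₂) :
    (squcoGadget G₁ G₂).IsSquco := by
  have : Nonempty V₂ := ‹Nonempty V₁›.map e
  rw [squcoGadget, (BipGraph.close_H h₁ h₂).isSquco_iff]
  exact ⟨(BipGraph.Iso.mapH e.incidence e.symm.incidence.compl).toGraph.trans
    (gadgetComplIso G₁ G₂).symm.toGraph⟩

/-- An isomorphism of the gadget and its bipartite complement respects the bipartitions, as there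
are more right than left vertices, so it is an isomorphism of the gadgets of `G₁`, `G₂` and of
`G₂`, `G₁`. -/
theorem iso_of_isSquco_gadget [Finite V₁] [Finite V₂] [Nonempty V₁]
    (hV : Nat.card V₁ = Nat.card V₂) (hE : Nat.card G₁.edgeSet = Nat.card G₂.edgeSet)
    (hVE : Nat.card V₁ < Nat.card G₁.edgeSet)
    (h₁ : G₁.incidence.toGraph.NoIsolated) (h₁' : G₁.incidence.compl.toGraph.NoIsolated)
    (h₂ : G₂.incidence.toGraph.NoIsolated) (h₂' : G₂.incidence.compl.toGraph.NoIsolated)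
    (h : (squcoGadget G₁ G₂).IsSquco) : Nonempty (G₁ ≃g G₂) := by
  have : Nonempty V₂ := (Nat.card_pos_iff.1 (hV ▸ Nat.card_pos (α := V₁))).1
  have hK := BipGraph.close_H h₁ h₂'
  have hL := BipGraph.close_H h₂ h₁'
  rw [squcoGadget, hK.isSquco_iff] at h
  obtain ⟨e⟩ := h
  obtain ⟨e'⟩ := hL.exists_iso (by simp only [Nat.card_sum, Nat.card_fin]; omega)
    (e.trans (gadgetComplIso G₁ G₂).toGraph)
  exact e'.graphIso_of_H hV hV hV.symm

end Gadget

/-! ### Padding -/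

namespace SimpleGraph

variable {V W : Type*} {G : SimpleGraph V} {G' : SimpleGraph W}

@[simp] theorem pad_adj_inl_inl {u v : V} : G.pad.Adj (.inl u) (.inl v) ↔ G.Adj u v := by
  simp [pad]

@[simp] theorem pad_adj_inl_inr {v : V} {i : Fin 2} : G.pad.Adj (.inl v) (.inr i) := by
  simp [pad]

@[simp] theorem pad_adj_inr_inl {v : V} {i : Fin 2} : G.pad.Adj (.inr i) (.inl v) := by
  simp [pad]

@[simp] theorem pad_adj_inr_inr {i j : Fin 2} : G.pad.Adj (.inr i) (.inr j) ↔ i ≠ j := by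
  simp [pad]

theorem pad_isUniversal (i : Fin 2) (x : V ⊕ Fin 2) (h : .inr i ≠ x) :
    G.pad.Adj (.inr i) x := by
  rcases x with x | j
  · simp
  · simpa using h

/-- Exchanging two universal vertices is an automorphism. -/
def swapUniversal [DecidableEq V] (G : SimpleGraph V) {u v : V} (hu : ∀ x, u ≠ x → G.Adj u x)
    (hv : ∀ x, v ≠ x → G.Adj v x) : G ≃g G where
  toEquiv := Equiv.swap u v
  map_rel_iff' {x y} := by
    have hu' : ∀ x, u ≠ x → G.Adj x u := fun x h => (hu x h).symm
    have hv' : ∀ x, v ≠ x → G.Adj x v := fun x h => (hv x h).symm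
    have hi : ∀ x, ¬ G.Adj x x := fun x => G.irrefl
    rw [Equiv.swap_apply_def, Equiv.swap_apply_def]
    grind

theorem Iso.universal (e : G ≃g G') {u : V} (hu : ∀ x, u ≠ x → G.Adj u x) (y : W)
    (h : e u ≠ y) : G'.Adj (e u) y := by
  rw [← e.apply_symm_apply y]
  refine e.map_adj_iff.2 (hu _ fun h' => h ?_)
  rw [h', e.apply_symm_apply]

/-- Padding respects isomorphism. -/
def Iso.pad (e : G ≃g G') : G.pad ≃g G'.pad where
  toEquiv := Equiv.sumCongr e.toEquiv (Equiv.refl _)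
  map_rel_iff' := by
    rintro (a | i) (b | j)
    · simpa using e.map_adj_iff
    · simp
    · simp
    · simp

/-- An isomorphism of padded graphs can be corrected, by exchanging universal vertices, to one that
fixes the new vertices; so the original graphs are isomorphic. -/
theorem iso_of_pad (e : G.pad ≃g G'.pad) : Nonempty (G ≃g G') := by
  classical
  let e₁ : G.pad ≃g G'.pad :=
    e.trans (swapUniversal G'.pad (e.universal (pad_isUniversal 0)) (pad_isUniversal 0))
  have h₁ : e₁ (.inr 0) = .inr 0 := Equiv.swap_apply_left _ _
  let e₂ : G.pad ≃g G'.pad :=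
    e₁.trans (swapUniversal G'.pad (e₁.universal (pad_isUniversal 1)) (pad_isUniversal 1))
  have h₂ : e₂ (.inr 0) = .inr 0 := by
    change Equiv.swap (e₁ (.inr 1)) (.inr 1) (e₁ (.inr 0)) = .inr 0
    rw [h₁]
    refine Equiv.swap_apply_of_ne_of_ne ?_ (by simp)
    rw [← h₁]
    exact e₁.injective.ne (by simp)
  have h₃ : e₂ (.inr 1) = .inr 1 := Equiv.swap_apply_left _ _
  have hr : ∀ i, e₂ (.inr i) = .inr i := by
    intro i; fin_cases i <;> assumption
  have hr' : ∀ i, e₂.symm (.inr i) = .inr i := fun i => by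
    rw [← hr i, e₂.symm_apply_apply]
  have hl : ∀ v, ∃ w, e₂ (.inl v) = .inl w := fun v => by
    rcases h : e₂ (.inl v) with w | i
    · exact ⟨w, rfl⟩
    · rw [← hr] at h
      cases e₂.injective h
  have hl' : ∀ v, ∃ w, e₂.symm (.inl v) = .inl w := fun v => by
    rcases h : e₂.symm (.inl v) with w | i
    · exact ⟨w, rfl⟩
    · rw [← hr'] at h
      cases e₂.symm.injective h
  choose f hf using hl
  choose f' hf' using hl'
  refine ⟨⟨⟨f, f', fun v => Sum.inl_injective (β := Fin 2) ?_,
    fun v => Sum.inl_injective (β := Fin 2) ?_⟩, fun {u v} => ?_⟩⟩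
  · rw [← hf', ← hf, e₂.symm_apply_apply]
  · rw [← hf, ← hf', e₂.apply_symm_apply]
  · have h := e₂.map_adj_iff (v := .inl u) (w := .inl v)
    rw [hf, hf] at h
    simpa using h

theorem pad_noIsolated (G : SimpleGraph V) : G.pad.incidence.toGraph.NoIsolated := by
  rintro (x | ⟨x, hx⟩)
  · rcases x with v | i
    · exact ⟨.inr ⟨s(.inl v, .inr 0), pad_adj_inl_inr⟩, Sym2.mem_mk_left _ _⟩
    · refine ⟨.inr ⟨s(.inr 0, .inr 1), by simp⟩, ?_⟩
      change Sum.inr i ∈ s(Sum.inr 0, Sum.inr 1)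
      fin_cases i <;> simp
  · induction x with
    | _ a b => exact ⟨.inl a, Sym2.mem_mk_left _ _⟩

theorem pad_compl_noIsolated [Nonempty V] (G : SimpleGraph V) :
    G.pad.incidence.compl.toGraph.NoIsolated := by
  obtain ⟨v₀⟩ := ‹Nonempty V›
  rintro (x | ⟨x, hx⟩)
  · rcases x with v | i
    · refine ⟨.inr ⟨s(.inr 0, .inr 1), by simp⟩, ?_⟩
      change ¬ Sum.inl v ∈ s(Sum.inr 0, Sum.inr 1)
      simp
    · refine ⟨.inr ⟨s(.inl v₀, .inr (i + 1)), pad_adj_inl_inr⟩, ?_⟩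
      change ¬ Sum.inr i ∈ s(Sum.inl v₀, Sum.inr (i + 1))
      fin_cases i <;> simp
  · have : ∃ a, a ∉ x := by
      by_contra! h
      induction x with
      | _ a b =>
        have h0 := h (.inr 0)
        have h1 := h (.inr 1)
        have h2 := h (.inl v₀)
        rw [Sym2.mem_iff] at h0 h1 h2
        grind
    obtain ⟨a, ha⟩ := this
    exact ⟨.inl a, ha⟩

theorem card_edgeSet_pad [Finite V] (G : SimpleGraph V) :
    Nat.card G.pad.edgeSet = Nat.card G.edgeSet + 2 * Nat.card V + 1 := by
  classical
  have := Fintype.ofFinite V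
  have h := G.sum_degrees_eq_twice_card_edges
  have h' := G.pad.sum_degrees_eq_twice_card_edges
  have hdeg : ∀ v, G.pad.degree (.inl v) = G.degree v + 2 := fun v => by
    rw [← card_neighborFinset_eq_degree, ← card_neighborFinset_eq_degree,
      neighborFinset_eq_filter, neighborFinset_eq_filter, ← Fintype.card_subtype,
      ← Fintype.card_subtype, Fintype.card_congr (Equiv.subtypeSum), Fintype.card_sum]
    simp
  have hdeg' : ∀ i, G.pad.degree (.inr i) = Fintype.card V + 1 := fun i => by
    rw [← card_neighborFinset_eq_degree,
      neighborFinset_eq_filter, ← Fintype.card_subtype, Fintype.card_congr (Equiv.subtypeSum),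
      Fintype.card_sum]
    fin_cases i <;> simp
  rw [Fintype.sum_sum_type] at h'
  simp only [hdeg, hdeg', Finset.sum_add_distrib, h, Finset.sum_const, Finset.card_univ,
    Fintype.card_fin, smul_eq_mul] at h'
  rw [Nat.card_eq_fintype_card, Nat.card_eq_fintype_card, Nat.card_eq_fintype_card,
    ← edgeFinset_card, ← edgeFinset_card]
  omega

end SimpleGraph

/-- With `n` vertices and `m` edges in each graph, the padded graphs have `n + 2` vertices and
`m + 2 n + 1` edges, so `iso_of_isSquco_gadget` applies to them if `n > 1`. -/
theorem gadget_pad_iff {V₁ V₂ : Type*} [Finite V₁] [Finite V₂] [Nonempty V₁]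
    (G₁ : SimpleGraph V₁) (G₂ : SimpleGraph V₂) (hV : Nat.card V₁ = Nat.card V₂)
    (hE : Nat.card G₁.edgeSet = Nat.card G₂.edgeSet) :
    Nonempty (G₁ ≃g G₂) ↔ (squcoGadget G₁.pad G₂.pad).IsSquco := by
  have : Nonempty V₂ := (Nat.card_pos_iff.1 (hV ▸ Nat.card_pos (α := V₁))).1
  refine ⟨fun ⟨e⟩ => isSquco_gadget_of_iso G₁.pad_noIsolated G₂.pad_compl_noIsolated e.pad,
    fun h => ?_⟩
  rcases (Nat.succ_le_iff.2 (Nat.card_pos (α := V₁))).eq_or_lt with h1 | h1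
  · -- the padded graph of a one-vertex graph is a triangle, with only as many edges as vertices, so
    -- this case is treated directly
    have := (Nat.card_eq_one_iff_unique.1 h1.symm).1
    have := (Nat.card_eq_one_iff_unique.1 (hV ▸ h1.symm)).1
    obtain ⟨e⟩ := (Finite.card_eq (α := V₁) (β := V₂)).1 hV
    exact ⟨⟨e, fun {a b} => iff_of_false
      (by rw [Subsingleton.elim (e a) (e b)]; exact G₂.irrefl)
      (by rw [Subsingleton.elim a b]; exact G₁.irrefl)⟩⟩
  · obtain ⟨e⟩ := iso_of_isSquco_gadget (by simp [Nat.card_sum, hV])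
      (by rw [G₁.card_edgeSet_pad, G₂.card_edgeSet_pad, hV, hE])
      (by rw [G₁.card_edgeSet_pad, Nat.card_sum, Nat.card_fin]; omega)
      G₁.pad_noIsolated G₁.pad_compl_noIsolated G₂.pad_noIsolated G₂.pad_compl_noIsolated h
    exact SimpleGraph.iso_of_pad e

namespace RegMachine

/-! ### Boolean terms -/

variable {I O : Type} [DecidableEq I]

namespace Expr

/-- The truth value of `a ≤ b`. -/
def le (a b : Expr I) : Expr I := .sub .one (.sub a b)

/-- The truth value of `a < b`. -/
def lt (a b : Expr I) : Expr I := le (.add a .one) b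

/-- The truth value of `a = b`. -/
def eq (a b : Expr I) : Expr I := .mul (le a b) (le b a)

/-- The negation of a truth value. -/
def not (a : Expr I) : Expr I := .sub .one a

/-- The truth value of `a ≠ 0`. -/
def pos (a : Expr I) : Expr I := not (not a)

/-- `e` is the truth value of `P`. -/
def Decides (w : List I) (v : ℕ → ℕ) (e : Expr I) (P : Prop) [Decidable P] : Prop :=
  e.eval w v = if P then 1 else 0

variable {w : List I} {v : ℕ → ℕ} {a b : Expr I} {P Q : Prop} [Decidable P] [Decidable Q]

theorem decides_le : (le a b).Decides w v (a.eval w v ≤ b.eval w v) := by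
  simp only [Decides, le, eval]; split_ifs <;> omega

theorem decides_lt : (lt a b).Decides w v (a.eval w v < b.eval w v) := by
  simp only [Decides, lt, le, eval]; split_ifs <;> omega

theorem Decides.and (h : a.Decides w v P) (h' : b.Decides w v Q) :
    (mul a b).Decides w v (P ∧ Q) := by
  rw [Decides, eval, h, h', ite_and]; split_ifs <;> rfl

theorem decides_eq : (eq a b).Decides w v (a.eval w v = b.eval w v) := by
  have h := (decides_le (w := w) (v := v) (a := a) (b := b)).and
    (decides_le (w := w) (v := v) (a := b) (b := a))
  rw [Decides] at *
  rw [eq, h]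
  simp only [le_antisymm_iff]

theorem Decides.not (h : a.Decides w v P) : a.not.Decides w v (¬ P) := by
  rw [Decides, Expr.not, eval, eval, h]; split_ifs <;> rfl

theorem decides_pos : a.pos.Decides w v (a.eval w v ≠ 0) := by
  simp only [Decides, pos, Expr.not, eval]; split_ifs <;> omega

theorem Decides.or (h : a.Decides w v P) (h' : b.Decides w v Q) :
    (pos (add a b)).Decides w v (P ∨ Q) := by
  have h2 := decides_pos (a := add a b) (w := w) (v := v)
  rw [Decides] at *
  rw [h2, eval, h, h']
  by_cases hP : P <;> by_cases hQ : Q <;> simp [hP, hQ]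

theorem Decides.congr (h : a.Decides w v P) (e : P ↔ Q) : a.Decides w v Q := by
  rw [Decides] at *
  rw [h]
  simp only [e]

theorem decides_one : (one : Expr I).Decides w v True := rfl

theorem decides_zero : (not one : Expr I).Decides w v False := rfl

end Expr

namespace WordProg

/-- Write the word given by `p` if the truth value `e` is one. The bound variable `0` is not used
otherwise. -/
def cond (e : Expr I) (p : WordProg I O) : WordProg I O := .rep 0 e p

/-- Write one of two symbols. -/
def choose (e : Expr I) (s t : O) : WordProg I O := .seq (cond e (.emit s)) (cond e.not (.emit t))

variable {w : List I} {v : ℕ → ℕ} {e : Expr I} {P : Prop} [Decidable P]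

theorem eval_cond {p : WordProg I O} (h : e.Decides w v P) (hv : v 0 = 0) :
    (cond e p).eval w v = if P then p.eval w v else [] := by
  have : Function.update v 0 0 = v := Function.update_eq_self_iff.2 hv.symm
  rw [cond, eval, h]
  split_ifs <;> simp [this]

theorem eval_choose {s t : O} (h : e.Decides w v P) (hv : v 0 = 0) :
    (choose e s t : WordProg I O).eval w v = [if P then s else t] := by
  rw [choose, eval, eval_cond h hv, eval_cond h.not hv]
  by_cases hP : P <;> simp [hP, eval]

end WordProg

end RegMachine

/-! ### Adjacency matrices -/

/-- Position `i * k + j` in a concatenation of blocks of length `k`. -/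
theorem List.getElem?_flatMap_block {α β : Type*} {k : ℕ} (f : α → List β)
    (hk : ∀ x, (f x).length = k) {j : ℕ} (hj : j < k) (l : List α) (i : ℕ) :
    (l.flatMap f)[i * k + j]? = l[i]?.bind fun x => (f x)[j]? := by
  induction l generalizing i with
  | nil => simp
  | cons x l ih =>
    rw [List.flatMap_cons]
    cases i with
    | zero => simpa using List.getElem?_append_left (by rw [hk]; exact hj)
    | succ i =>
      rw [List.getElem?_append_right (by rw [hk]; nlinarith), hk,
        show (i + 1) * k + j - k = i * k + j by rw [Nat.succ_mul]; omega, ih]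
      simp

namespace FinGraph

/-- Adjacency of the vertices with numbers `i` and `j`. -/
def NatAdj (G : FinGraph) (i j : ℕ) : Prop := ∃ (hi : i < G.n) (hj : j < G.n),
  G.graph.Adj ⟨i, hi⟩ ⟨j, hj⟩

theorem natAdj_iff (G : FinGraph) (i j : Fin G.n) : G.NatAdj i j ↔ G.graph.Adj i j :=
  ⟨fun ⟨_, _, h⟩ => h, fun h => ⟨i.2, j.2, h⟩⟩

theorem length_encodeRow (G : FinGraph) (i : Fin G.n) : (G.encodeRow i).length = G.n + 1 := by
  simp [encodeRow]

theorem length_encode (G : FinGraph) : G.encode.length = G.n * (G.n + 1) := by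
  simp [encode, List.length_flatMap, length_encodeRow]

theorem count_encode [BEq (Option Bool)] [LawfulBEq (Option Bool)] {G : FinGraph} :
    G.encode.count none = G.n := by
  have h : ∀ i, (G.encodeRow i).count none = 1 := by
    intro i
    rw [encodeRow, List.count_append, List.count_eq_zero.2 (by simp)]
    simp
  rw [encode, List.count_flatMap, show List.count none ∘ G.encodeRow = fun _ => 1 from funext h]
  simp

theorem getElem?_encode (G : FinGraph) (i j : ℕ) (hj : j < G.n) :
    G.encode[i * (G.n + 1) + j]? = some (some true) ↔ G.NatAdj i j := by
  rw [encode, List.getElem?_flatMap_block _ G.length_encodeRow (by omega)]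
  by_cases hi : i < G.n
  · rw [List.getElem?_eq_getElem (by simpa using hi)]
    simp only [List.getElem_finRange, Option.bind_some]
    rw [encodeRow, List.getElem?_append_left (by simpa using hj),
      List.getElem?_eq_getElem (by simpa using hj)]
    simp only [List.getElem_map, List.getElem_finRange, Option.some.injEq, decide_eq_true_eq]
    exact ⟨fun h => ⟨hi, hj, h⟩, fun ⟨_, _, h⟩ => h⟩
  · rw [List.getElem?_eq_none (by simpa using hi)]
    exact iff_of_false (by simp) fun ⟨h, _⟩ => hi h

theorem map_val_finRange (n : ℕ) : (List.finRange n).map Fin.val = List.range n :=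
  List.ext_getElem (by simp) (by simp)

theorem finRange_flatMap {α : Type*} (n : ℕ) (f : ℕ → List α) :
    (List.finRange n).flatMap (fun i : Fin n => f i) = (List.range n).flatMap f := by
  rw [← map_val_finRange, List.flatMap_map]

open Classical in
theorem encode_eq (G : FinGraph) : G.encode = (List.range G.n).flatMap fun i =>
    (List.range G.n).map (fun j => some (decide (G.NatAdj i j))) ++ [none] := by
  rw [← finRange_flatMap, encode]
  refine List.flatMap_congr fun i _ => ?_
  rw [encodeRow, ← map_val_finRange, List.map_map]
  refine congrArg (· ++ [none]) (List.map_congr_left fun j _ => ?_)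
  simp only [Function.comp, natAdj_iff]

end FinGraph

/-! ### Reduction of square-complementarity to graph isomorphism -/

namespace RegMachine

variable {I O : Type} [DecidableEq I]

/-- Write the matrix of the truth value `e` of the variables `1` and `2` below `n`. -/
def matrix (n e : Expr I) (emb : Option Bool → O) : WordProg I O :=
  .rep 1 n (.seq (.rep 2 n (.choose e (emb (some true)) (emb (some false)))) (.emit (emb none)))

open Classical in
theorem eval_matrix {w : List I} {n e : Expr I} (emb : Option Bool → O) (G : FinGraph)
    (hn : ∀ v, n.eval w v = G.n)
    (he : ∀ v, v 1 < G.n → v 2 < G.n → e.Decides w v (G.NatAdj (v 1) (v 2))) :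
    (matrix n e emb).eval w (fun _ => 0) = G.encode.map emb := by
  rw [matrix, WordProg.eval, hn, G.encode_eq, List.map_flatMap]
  refine List.flatMap_congr fun i hi => ?_
  rw [WordProg.eval, WordProg.eval, WordProg.eval, hn, List.map_append, List.map_map,
    ← List.flatMap_singleton' (List.map _ _), List.flatMap_map]
  congr 1
  refine List.flatMap_congr fun j hj => ?_
  rw [WordProg.eval_choose (he _ (by simpa using hi) (by simpa using hj)) (by simp)]
  simp only [Function.update_self, ne_eq, OfNat.one_ne_ofNat, not_false_eq_true,
    Function.update_of_ne, Function.comp]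
  by_cases h : G.NatAdj i j <;> simp [h]

/-- The truth value of adjacency of the vertices `a` and `b`, in a graph with `n` vertices whose
matrix starts at position `p` and marks edges by `s`. -/
def adjExpr (s : I) (n p a b : Expr I) : Expr I :=
  .look s (.add p (.add (.mul a (.add n .one)) b))

/-- The code of the square and the complement of a graph. -/
def squareComplProg : WordProg (Option Bool) (Option Bool ⊕ Option Bool) :=
  let n : Expr (Option Bool) := .count none
  let adj := adjExpr (some true) n (.not .one)
  let x := Expr.var 1
  let y := Expr.var 2
  let z := Expr.var 3
  .seq
    (matrix n (.mul (.not (.eq x y))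
      (.pos (.add (adj x y) (.pos (.sum 3 n (.mul (adj x z) (adj z y))))))) .inl)
    (matrix n (.mul (.not (.eq x y)) (.not (adj x y))) .inr)

/-- The reduction of square-complementarity to graph isomorphism. -/
noncomputable def squareCompl (G : FinGraph) : FinGraph × FinGraph :=
  (⟨G.n, G.graph.square⟩, ⟨G.n, G.graphᶜ⟩)

open Classical in
theorem eval_squareComplProg (G : FinGraph) :
    squareComplProg.eval G.encode (fun _ => 0) = FinGraph.encodePair (squareCompl G) := by
  have hn : ∀ v, (Expr.count none : Expr (Option Bool)).eval G.encode v = G.n :=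
    fun _ => @FinGraph.count_encode instBEqOfDecidableEq _ G
  have hadj : ∀ (a b : Expr (Option Bool)) (v : ℕ → ℕ), b.eval G.encode v < G.n →
      (adjExpr (some true) (.count none) (.not .one) a b).Decides G.encode v
        (G.NatAdj (a.eval G.encode v) (b.eval G.encode v)) := by
    intro a b v hb
    rw [Expr.Decides, adjExpr, Expr.eval]
    simp only [← G.getElem?_encode _ _ hb]
    simp only [Expr.eval, Expr.not, @FinGraph.count_encode instBEqOfDecidableEq _ G, Nat.sub_self,
      zero_add]
  rw [squareComplProg, WordProg.eval, FinGraph.encodePair]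
  congr 1
  · refine eval_matrix _ (squareCompl G).1 hn fun v h1 h2 => ?_
    have h1' : v 1 < G.n := h1
    have h2' : v 2 < G.n := h2
    have hsum : (Expr.sum 3 (.count none) (.mul
        (adjExpr (some true) (.count none) (.not .one) (.var 1) (.var 3))
        (adjExpr (some true) (.count none) (.not .one) (.var 3) (.var 2)))).eval G.encode v ≠ 0 ↔
        ∃ k, G.NatAdj (v 1) k ∧ G.NatAdj k (v 2) := by
      have key : ∀ k < G.n, (Expr.mul
          (adjExpr (some true) (.count none) (.not .one) (.var 1) (.var 3))
          (adjExpr (some true) (.count none) (.not .one) (.var 3) (.var 2))).Decides G.encode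
            (Function.update v 3 k) (G.NatAdj (v 1) k ∧ G.NatAdj k (v 2)) := fun k hk => by
        have hl := hadj (.var 1) (.var 3) (Function.update v 3 k) (by simpa [Expr.eval] using hk)
        have hr := hadj (.var 3) (.var 2) (Function.update v 3 k) (by simpa [Expr.eval] using h2')
        exact (hl.and hr).congr (by simp [Expr.eval])
      rw [Expr.eval, hn, ne_eq, Finset.sum_eq_zero_iff]
      push Not
      refine exists_congr fun k => ⟨fun ⟨hk, h⟩ => ?_, fun h => ?_⟩
      · rw [key k (Finset.mem_range.1 hk)] at h
        simpa using h
      · obtain ⟨hk, -⟩ := h.2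
        refine ⟨Finset.mem_range.2 hk, ?_⟩
        rw [key k hk, if_pos h]
        exact one_ne_zero
    refine ((Expr.decides_eq.not).and ((hadj (.var 1) (.var 2) v h2).or
      (Expr.decides_pos.congr hsum))).congr ?_
    simp only [Expr.eval]
    constructor
    · rintro ⟨hne, h⟩
      refine ⟨h1, h2, (SimpleGraph.square_adj_iff _).2 ⟨fun h => hne (congrArg Fin.val h), ?_⟩⟩
      rcases h with ⟨_, _, h⟩ | ⟨k, ⟨_, hk, h⟩, ⟨_, _, h'⟩⟩
      · exact Or.inl h
      · exact Or.inr ⟨⟨k, hk⟩, h, h'⟩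
    · rintro ⟨_, _, h⟩
      obtain ⟨hne, h⟩ := (SimpleGraph.square_adj_iff _).1 h
      refine ⟨fun h => hne (Fin.ext h), ?_⟩
      rcases h with h | ⟨k, h, h'⟩
      · exact Or.inl ⟨h1, h2, h⟩
      · exact Or.inr ⟨k, ⟨h1, k.2, h⟩, ⟨k.2, h2, h'⟩⟩
  · refine eval_matrix _ (squareCompl G).2 hn fun v h1 h2 => ?_
    refine ((Expr.decides_eq.not).and (hadj (.var 1) (.var 2) v h2).not).congr ?_
    simp only [Expr.eval]
    constructor
    · rintro ⟨hne, h⟩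
      exact ⟨h1, h2, fun h => hne (congrArg Fin.val h), fun h' => h ⟨h1, h2, h'⟩⟩
    · rintro ⟨_, _, hne, h⟩
      exact ⟨fun h => hne (Fin.ext h), fun ⟨_, _, h'⟩ => h h'⟩

theorem squareCompl_isReduction :
    DecisionProblem.IsReduction DecisionProblem.squco DecisionProblem.graphIso squareCompl :=
  ⟨polyTime_of_wordProg (I := Option Bool) (O := Option Bool ⊕ Option Bool)
    (ea := FinGraph.encode) (eb := FinGraph.encodePair) squareComplProg eval_squareComplProg,
    fun _ => Iff.rfl⟩

end RegMachine

/-! ### Graphs on the entries of a list -/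

namespace FinGraph

/-- The graph whose vertices are the positions of a list of vertices of `S`. -/
def ofList {τ : Type} (S : SimpleGraph τ) (T : List τ) : FinGraph :=
  ⟨T.length, S.comap T.get⟩

open Classical in
theorem encode_ofList {τ : Type} (S : SimpleGraph τ) (T : List τ) :
    (ofList S T).encode = T.flatMap fun t =>
      T.map (fun t' => some (decide (S.Adj t t'))) ++ [none] := by
  have hT : (List.finRange T.length).map T.get = T := List.ext_getElem (by simp) (by simp)
  conv_rhs => rw [← hT, List.flatMap_map]
  refine List.flatMap_congr fun i _ => congrArg (· ++ [none]) ?_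
  rw [List.map_map]
  exact List.map_congr_left fun j _ => rfl

end FinGraph

/-! ### The vertices of the gadget as triples of numbers -/

/-- The kinds of vertices of the gadget: the parts `A`, `A'`, `C` of the left side and the parts
`B`, `B'`, `D` of the right side. -/
inductive VertexKind
  | A | A' | C | B | B' | D
  deriving DecidableEq

namespace VertexKind

/-- All kinds of vertices. -/
def all : List VertexKind := [A, A', C, B, B', D]

theorem mem_all (κ : VertexKind) : κ ∈ all := by cases κ <;> decide

end VertexKind

/-- A vertex of the gadget: `(A, v, 0)` and `(A', v, 0)` for the vertices `v` of the two graphs,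
`(B, u, v)` and `(B', u, v)` for their edges with end vertices `u < v`, and `(C, i, 0)` and
`(D, i, 0)` for the two vertices of `C` and of `D`. -/
abbrev GadgetCode : Type := VertexKind × ℕ × ℕ

/-- The edges of the gadget, directed from left to right. -/
def GadgetCode.LeftRight : GadgetCode → GadgetCode → Prop
  | (.A, v, _), (.B, x, y) => v = x ∨ v = y
  | (.A, _, _), (.D, _, _) => True
  | (.A', _, _), (.B, _, _) => True
  | (.A', v, _), (.B', x, y) => ¬ (v = x ∨ v = y)
  | (.C, _, _), (.B', _, _) => True
  | (.C, i, _), (.D, j, _) => i = j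
  | _, _ => False

/-- The gadget on the codes of its vertices. -/
def codeGraph : SimpleGraph GadgetCode where
  Adj s t := s.LeftRight t ∨ t.LeftRight s
  symm := ⟨fun _ _ h => h.symm⟩
  loopless := ⟨by rintro ⟨κ, i, j⟩ h; cases κ <;> exact h.elim id id⟩

/-- Adjacency of the numbers `i < j` in a padded graph with `n + 2` vertices. -/
def FinGraph.PadAdj (G : FinGraph) (i j : ℕ) : Prop := i < j ∧ (G.n ≤ j ∨ G.NatAdj i j)

/-- The codes that belong to vertices of the gadget of the padded graphs; the numbers are below
`n + 2`. -/
def GadgetCode.Valid (p : FinGraph × FinGraph) : GadgetCode → Prop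
  | (.A, _, j) | (.A', _, j) => j = 0
  | (.C, i, j) | (.D, i, j) => j = 0 ∧ i < 2
  | (.B, i, j) => p.1.PadAdj i j
  | (.B', i, j) => p.2.PadAdj i j

open Classical in
/-- The vertices of the gadget. -/
noncomputable def gadgetCodes (p : FinGraph × FinGraph) : List GadgetCode :=
  (VertexKind.all ×ˢ (List.range (p.1.n + 2) ×ˢ List.range (p.1.n + 2))).filter
    fun t => decide (t.Valid p)

theorem nodup_gadgetCodes (p : FinGraph × FinGraph) : (gadgetCodes p).Nodup :=
  (List.Nodup.product (by decide) (List.nodup_range.product List.nodup_range)).filter _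

theorem mem_gadgetCodes {p : FinGraph × FinGraph} {t : GadgetCode} :
    t ∈ gadgetCodes p ↔ (t.2.1 < p.1.n + 2 ∧ t.2.2 < p.1.n + 2) ∧ t.Valid p := by
  obtain ⟨κ, i, j⟩ := t
  simp [gadgetCodes, VertexKind.mem_all]

/-- The number of a vertex of the padded graph. -/
def padNum {n : ℕ} (x : Fin n ⊕ Fin 2) : ℕ := finSumFinEquiv x

theorem padNum_lt {n : ℕ} (x : Fin n ⊕ Fin 2) : padNum x < n + 2 := (finSumFinEquiv x).2

theorem padNum_injective {n : ℕ} : Function.Injective (padNum (n := n)) :=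
  Fin.val_injective.comp finSumFinEquiv.injective

theorem exists_padNum {n i : ℕ} (h : i < n + 2) : ∃ x : Fin n ⊕ Fin 2, padNum x = i :=
  ⟨finSumFinEquiv.symm ⟨i, h⟩, by rw [padNum, Equiv.apply_symm_apply]⟩

theorem FinGraph.padAdj_padNum (G : FinGraph) (x y : Fin G.n ⊕ Fin 2) :
    G.PadAdj (padNum x) (padNum y) ↔ padNum x < padNum y ∧ G.graph.pad.Adj x y := by
  refine and_congr_right fun h => ?_
  rcases x with x | x <;> rcases y with y | y
  · simp [padNum, natAdj_iff]
  · simp [padNum]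
  · simp [padNum] at h
    omega
  · simp only [padNum, finSumFinEquiv_apply_right, Fin.val_natAdd] at h ⊢
    simp only [SimpleGraph.pad_adj_inr_inr]
    exact iff_of_true (Or.inl (by omega)) fun h' => by subst h'; omega

/-- The end vertices of an edge of the padded graph, in increasing order. -/
def edgeNum {n : ℕ} (x : Sym2 (Fin n ⊕ Fin 2)) : ℕ × ℕ := ((x.map padNum).inf, (x.map padNum).sup)

theorem edgeNum_injective {n : ℕ} : Function.Injective (edgeNum (n := n)) := fun _ _ h =>
  Sym2.map.injective padNum_injective
    (Sym2.inf_eq_inf_and_sup_eq_sup.1 ⟨congrArg Prod.fst h, congrArg Prod.snd h⟩)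

theorem mem_iff_edgeNum {n : ℕ} (v : Fin n ⊕ Fin 2) (x : Sym2 (Fin n ⊕ Fin 2)) :
    v ∈ x ↔ padNum v = (edgeNum x).1 ∨ padNum v = (edgeNum x).2 := by
  induction x with
  | _ a b =>
    rw [Sym2.mem_iff, ← padNum_injective.eq_iff, ← padNum_injective.eq_iff (a := v) (b := b)]
    simp only [edgeNum, Sym2.map_mk, Sym2.inf_mk, Sym2.sup_mk]
    omega

theorem FinGraph.edgeNum_spec (G : FinGraph) (x : G.graph.pad.edgeSet) :
    ((edgeNum x.1).1 < G.n + 2 ∧ (edgeNum x.1).2 < G.n + 2) ∧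
      G.PadAdj (edgeNum x.1).1 (edgeNum x.1).2 := by
  obtain ⟨x, hx⟩ := x
  induction x with
  | _ a b =>
    have ha := padNum_lt a
    have hb := padNum_lt b
    simp only [edgeNum, Sym2.map_mk, Sym2.inf_mk, Sym2.sup_mk]
    have hx' : G.graph.pad.Adj a b := hx
    rcases lt_or_gt_of_ne (padNum_injective.ne hx'.ne) with h | h
    · rw [inf_eq_left.2 h.le, sup_eq_right.2 h.le]
      exact ⟨⟨ha, hb⟩, (G.padAdj_padNum _ _).2 ⟨h, hx'⟩⟩
    · rw [inf_eq_right.2 h.le, sup_eq_left.2 h.le]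
      exact ⟨⟨hb, ha⟩, (G.padAdj_padNum _ _).2 ⟨h, hx'.symm⟩⟩

theorem FinGraph.exists_edgeNum (G : FinGraph) {i j : ℕ} (hj : j < G.n + 2) (h : G.PadAdj i j) :
    ∃ x : G.graph.pad.edgeSet, edgeNum x.1 = (i, j) := by
  obtain ⟨a, rfl⟩ := exists_padNum (h.1.trans hj)
  obtain ⟨b, rfl⟩ := exists_padNum hj
  have h' := (G.padAdj_padNum _ _).1 h
  refine ⟨⟨s(a, b), h'.2⟩, ?_⟩
  simp only [edgeNum, Sym2.map_mk, Sym2.inf_mk, Sym2.sup_mk, inf_eq_left.2 h'.1.le,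
    sup_eq_right.2 h'.1.le]

section Iso

variable (p : FinGraph × FinGraph)

/-- The vertices of the gadget of the padded graphs. -/
abbrev GadgetVertex : Type :=
  ((Fin p.1.n ⊕ Fin 2) ⊕ (Fin p.2.n ⊕ Fin 2) ⊕ Fin 2) ⊕
    (p.1.graph.pad.edgeSet ⊕ p.2.graph.pad.edgeSet ⊕ Fin 2)

/-- The code of a vertex of the gadget. -/
def gadgetCode : GadgetVertex p → GadgetCode
  | .inl (.inl v) => (.A, padNum v, 0)
  | .inl (.inr (.inl v)) => (.A', padNum v, 0)
  | .inl (.inr (.inr i)) => (.C, i, 0)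
  | .inr (.inl x) => (.B, edgeNum x.1)
  | .inr (.inr (.inl x)) => (.B', edgeNum x.1)
  | .inr (.inr (.inr i)) => (.D, i, 0)

theorem gadgetCode_injective : Function.Injective (gadgetCode p) := by
  rintro ((v | v | i) | (x | x | i)) ((w | w | j) | (y | y | j)) h <;>
    simp only [gadgetCode, Prod.mk.injEq, reduceCtorEq, false_and, true_and, and_true] at h
  · rw [padNum_injective h]
  · rw [padNum_injective h]
  · rw [Fin.ext h]
  · rw [Subtype.ext (edgeNum_injective h)]
  · rw [Subtype.ext (edgeNum_injective h)]
  · rw [Fin.ext h]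

theorem gadgetCode_mem (hn : p.1.n = p.2.n) (x : GadgetVertex p) :
    gadgetCode p x ∈ gadgetCodes p := by
  rw [mem_gadgetCodes]
  rcases x with (v | v | i) | (x | x | i)
  · exact ⟨⟨padNum_lt v, Nat.succ_pos _⟩, rfl⟩
  · exact ⟨⟨(padNum_lt v).trans_eq (by rw [hn]), Nat.succ_pos _⟩, rfl⟩
  · exact ⟨⟨i.2.trans_le (by simp), Nat.succ_pos _⟩, rfl, i.2⟩
  · exact p.1.edgeNum_spec x
  · have h := p.2.edgeNum_spec x
    exact ⟨⟨h.1.1.trans_eq (by rw [hn]), h.1.2.trans_eq (by rw [hn])⟩, h.2⟩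
  · exact ⟨⟨i.2.trans_le (by simp), Nat.succ_pos _⟩, rfl, i.2⟩

theorem exists_gadgetCode (hn : p.1.n = p.2.n) {t : GadgetCode} (ht : t ∈ gadgetCodes p) :
    ∃ x, gadgetCode p x = t := by
  rw [mem_gadgetCodes] at ht
  obtain ⟨κ, i, j⟩ := t
  obtain ⟨⟨hi, hj⟩, h⟩ := ht
  dsimp only at hi hj
  cases κ with
  | A =>
    obtain ⟨v, rfl⟩ := exists_padNum hi
    obtain rfl : j = 0 := h
    exact ⟨.inl (.inl v), rfl⟩
  | A' =>
    obtain ⟨v, rfl⟩ := exists_padNum (hn ▸ hi)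
    obtain rfl : j = 0 := h
    exact ⟨.inl (.inr (.inl v)), rfl⟩
  | C =>
    obtain ⟨rfl, h2⟩ : j = 0 ∧ i < 2 := h
    exact ⟨.inl (.inr (.inr ⟨i, h2⟩)), rfl⟩
  | B =>
    obtain ⟨x, hx⟩ := p.1.exists_edgeNum hj h
    exact ⟨.inr (.inl x), congrArg _ hx⟩
  | B' =>
    obtain ⟨x, hx⟩ := p.2.exists_edgeNum (hn ▸ hj) h
    exact ⟨.inr (.inr (.inl x)), congrArg _ hx⟩
  | D =>
    obtain ⟨rfl, h2⟩ : j = 0 ∧ i < 2 := h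
    exact ⟨.inr (.inr (.inr ⟨i, h2⟩)), rfl⟩

theorem gadgetCode_leftRight (x : (Fin p.1.n ⊕ Fin 2) ⊕ (Fin p.2.n ⊕ Fin 2) ⊕ Fin 2)
    (y : p.1.graph.pad.edgeSet ⊕ p.2.graph.pad.edgeSet ⊕ Fin 2) :
    (gadgetCode p (.inl x)).LeftRight (gadgetCode p (.inr y)) ↔
      (BipGraph.H p.1.graph.pad.incidence p.2.graph.pad.incidence.compl).Adj x y := by
  rcases x with v | v | i <;> rcases y with x | x | j
  · exact (mem_iff_edgeNum v x.1).symm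
  · exact Iff.rfl
  · exact Iff.rfl
  · exact Iff.rfl
  · exact not_congr (mem_iff_edgeNum v x.1).symm
  · exact Iff.rfl
  · exact Iff.rfl
  · exact Iff.rfl
  · exact Fin.ext_iff.symm

theorem gadgetCode_adj (x y : GadgetVertex p) :
    codeGraph.Adj (gadgetCode p x) (gadgetCode p y) ↔
      (squcoGadget p.1.graph.pad p.2.graph.pad).Adj x y := by
  have hf : ∀ s (t : GadgetVertex p),
      (gadgetCode p (.inr s)).LeftRight (gadgetCode p t) → False := by
    rintro (s | s | s) ((t | t | t) | (t | t | t)) h <;> exact h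
  have hf' : ∀ (s : GadgetVertex p) t,
      (gadgetCode p s).LeftRight (gadgetCode p (.inl t)) → False := by
    rintro ((s | s | s) | (s | s | s)) (t | t | t) h <;> exact h
  rcases x with x | x <;> rcases y with y | y
  · exact iff_of_false (fun h => h.elim (hf' _ _) (hf' _ _)) id
  · exact (or_iff_left (hf _ _)).trans (gadgetCode_leftRight p x y)
  · exact (or_iff_right (hf _ _)).trans (gadgetCode_leftRight p y x)
  · exact iff_of_false (fun h => h.elim (hf _ _) (hf _ _)) id

theorem ofList_iso_gadget (hn : p.1.n = p.2.n) :
    Nonempty ((FinGraph.ofList codeGraph (gadgetCodes p)).graph ≃g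
      squcoGadget p.1.graph.pad p.2.graph.pad) := by
  let e : GadgetVertex p ≃ {t // t ∈ gadgetCodes p} :=
    Equiv.ofBijective (fun x => ⟨gadgetCode p x, gadgetCode_mem p hn x⟩)
      ⟨fun x y h => gadgetCode_injective p (congrArg Subtype.val h),
        fun t => (exists_gadgetCode p hn t.2).imp fun x hx => Subtype.ext hx⟩
  let g := (nodup_gadgetCodes p).getEquiv
  refine ⟨⟨g.trans e.symm, fun {a b} => ?_⟩⟩
  rw [← gadgetCode_adj]
  have h : ∀ a, gadgetCode p ((g.trans e.symm) a) = (gadgetCodes p).get a := fun a =>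
    congrArg Subtype.val (e.apply_symm_apply (g a))
  exact Iff.of_eq (congrArg₂ codeGraph.Adj (h a) (h b))

end Iso

/-! ### Reduction of graph isomorphism to square-complementarity -/

open Classical in
/-- The reduction: a graph that is not squco if the numbers of vertices or of edges differ, the
empty graph if both graphs are empty, and the gadget of the padded graphs otherwise. -/
noncomputable def toGadget (p : FinGraph × FinGraph) : FinGraph :=
  if p.1.n = p.2.n ∧ Nat.card p.1.graph.edgeSet = Nat.card p.2.graph.edgeSet then
    if p.1.n = 0 then ⟨0, ⊥⟩ else FinGraph.ofList codeGraph (gadgetCodes p)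
  else ⟨2, ⊥⟩

theorem not_isSquco_two : ¬ (⊥ : SimpleGraph (Fin 2)).IsSquco := by
  rintro ⟨e⟩
  have h : (⊥ : SimpleGraph (Fin 2))ᶜ.Adj 0 1 := by simp
  have h' := e.symm.map_adj_iff.2 h
  obtain ⟨-, h' | ⟨z, h', -⟩⟩ := (SimpleGraph.square_adj_iff _).1 h' <;> exact h'

theorem isSquco_of_isEmpty {V : Type*} [IsEmpty V] (G : SimpleGraph V) : G.IsSquco :=
  ⟨⟨Equiv.refl V, fun {a} => isEmptyElim a⟩⟩

theorem toGadget_of_pos {p : FinGraph × FinGraph} (h : p.1.n = p.2.n)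
    (h' : Nat.card p.1.graph.edgeSet = Nat.card p.2.graph.edgeSet) (h0 : p.1.n ≠ 0) :
    toGadget p = FinGraph.ofList codeGraph (gadgetCodes p) := by
  rw [toGadget, if_pos ⟨h, h'⟩, if_neg h0]

/-- `toGadget` preserves yes-instances and no-instances. -/
theorem yes_toGadget (p : FinGraph × FinGraph) :
    Nonempty (p.1.graph ≃g p.2.graph) ↔ (toGadget p).graph.IsSquco := by
  by_cases h : p.1.n = p.2.n ∧ Nat.card p.1.graph.edgeSet = Nat.card p.2.graph.edgeSet
  · by_cases h0 : p.1.n = 0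
    · have h1 : IsEmpty (Fin p.1.n) := by rw [h0]; infer_instance
      have h2 : IsEmpty (Fin p.2.n) := by rw [← h.1, h0]; infer_instance
      have ht : toGadget p = ⟨0, ⊥⟩ := by rw [toGadget, if_pos h, if_pos h0]
      rw [ht]
      exact iff_of_true ⟨⟨Equiv.equivOfIsEmpty _ _, fun {a} => isEmptyElim a⟩⟩
        (isSquco_of_isEmpty (V := Fin 0) ⊥)
    · have : NeZero p.1.n := ⟨h0⟩
      obtain ⟨e⟩ := ofList_iso_gadget p h.1
      rw [toGadget_of_pos h.1 h.2 h0, e.isSquco_iff]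
      exact gadget_pad_iff _ _ (by simpa using h.1) h.2
  · have ht : toGadget p = ⟨2, ⊥⟩ := by rw [toGadget, if_neg h]
    rw [ht]
    refine iff_of_false (fun ⟨e⟩ => h ⟨?_, Nat.card_congr e.mapEdgeSet⟩) not_isSquco_two
    simpa using Nat.card_congr e.toEquiv

/-! ### A program for the reduction -/

theorem List.flatMap_filter_ite {α β : Type*} (q : α → Bool) (f : α → List β) (l : List α) :
    (l.filter q).flatMap f = l.flatMap fun x => if q x then f x else [] := by
  induction l with
  | nil => rfl
  | cons x l ih =>
    rw [List.filter_cons, List.flatMap_cons, ← ih]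
    split_ifs <;> simp

namespace FinGraph

theorem count_inl_encodePair [BEq (Option Bool ⊕ Option Bool)]
    [LawfulBEq (Option Bool ⊕ Option Bool)] (p : FinGraph × FinGraph) :
    (encodePair p).count (.inl none) = p.1.n := by
  rw [encodePair, List.count_append, List.count_map_of_injective _ _ Sum.inl_injective,
    List.count_eq_zero_of_not_mem (l := p.2.encode.map Sum.inr) (by simp), count_encode, add_zero]

theorem count_inr_encodePair [BEq (Option Bool ⊕ Option Bool)]
    [LawfulBEq (Option Bool ⊕ Option Bool)] (p : FinGraph × FinGraph) :
    (encodePair p).count (.inr none) = p.2.n := by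
  rw [encodePair, List.count_append, List.count_map_of_injective _ _ Sum.inr_injective,
    List.count_eq_zero_of_not_mem (l := p.1.encode.map Sum.inl) (by simp), count_encode, zero_add]

theorem getElem?_inl_encodePair (p : FinGraph × FinGraph) {i j : ℕ} (hi : i < p.1.n)
    (hj : j < p.1.n) :
    (encodePair p)[i * (p.1.n + 1) + j]? = some (.inl (some true)) ↔ p.1.NatAdj i j := by
  rw [← p.1.getElem?_encode _ _ hj, encodePair, List.getElem?_append_left, List.getElem?_map]
  · simp
  · rw [List.length_map, length_encode]
    nlinarith

theorem getElem?_inr_encodePair (p : FinGraph × FinGraph) (i : ℕ) {j : ℕ} (hj : j < p.2.n) :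
    (encodePair p)[p.1.n * (p.1.n + 1) + (i * (p.2.n + 1) + j)]? = some (.inr (some true)) ↔
      p.2.NatAdj i j := by
  have h : p.1.n * (p.1.n + 1) = (p.1.encode.map (Sum.inl (β := Option Bool))).length := by
    rw [List.length_map, length_encode]
  rw [← p.2.getElem?_encode _ _ hj, encodePair, h,
    List.getElem?_append_right (Nat.le_add_right _ _), Nat.add_sub_cancel_left, List.getElem?_map]
  simp

end FinGraph

open Classical in
/-- The number of ones in the adjacency matrix. -/
theorem FinGraph.sum_natAdj (G : FinGraph) :
    (∑ i ∈ Finset.range G.n, ∑ j ∈ Finset.range G.n, if G.NatAdj i j then 1 else 0) =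
      2 * Nat.card G.graph.edgeSet := by
  rw [Nat.card_eq_fintype_card, ← SimpleGraph.edgeFinset_card,
    ← SimpleGraph.sum_degrees_eq_twice_card_edges, Finset.sum_range]
  refine Finset.sum_congr rfl fun i _ => ?_
  rw [Finset.sum_range, ← SimpleGraph.card_neighborFinset_eq_degree,
    SimpleGraph.neighborFinset_eq_filter, Finset.card_filter]
  simp only [natAdj_iff]

namespace RegMachine

namespace PairCode

/-- The number of vertices of the first graph of a pair. -/
def n₁ : Expr (Option Bool ⊕ Option Bool) := .count (.inl none)

/-- The number of vertices of the second graph of a pair. -/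
def n₂ : Expr (Option Bool ⊕ Option Bool) := .count (.inr none)

/-- Adjacency in the first graph of a pair. -/
def adj₁ (a b : Expr (Option Bool ⊕ Option Bool)) : Expr (Option Bool ⊕ Option Bool) :=
  adjExpr (.inl (some true)) n₁ (.not .one) a b

/-- Adjacency in the second graph of a pair, whose matrix follows the `n (n + 1)` symbols of the
first one. -/
def adj₂ (a b : Expr (Option Bool ⊕ Option Bool)) : Expr (Option Bool ⊕ Option Bool) :=
  adjExpr (.inr (some true)) n₂ (.mul n₁ (.add n₁ .one)) a b

variable (p : FinGraph × FinGraph) (v : ℕ → ℕ)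

theorem eval_n₁ : n₁.eval (FinGraph.encodePair p) v = p.1.n :=
  @FinGraph.count_inl_encodePair instBEqOfDecidableEq _ p

theorem eval_n₂ : n₂.eval (FinGraph.encodePair p) v = p.2.n :=
  @FinGraph.count_inr_encodePair instBEqOfDecidableEq _ p

variable {p v} {a b : Expr (Option Bool ⊕ Option Bool)}

open Classical in
theorem decides_adj₁ (ha : a.eval (FinGraph.encodePair p) v < p.1.n)
    (hb : b.eval (FinGraph.encodePair p) v < p.1.n) :
    (adj₁ a b).Decides (FinGraph.encodePair p) v
      (p.1.NatAdj (a.eval (FinGraph.encodePair p) v) (b.eval (FinGraph.encodePair p) v)) := by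
  rw [Expr.Decides, adj₁, adjExpr, Expr.eval]
  simp only [← FinGraph.getElem?_inl_encodePair p ha hb, Expr.eval, Expr.not, eval_n₁, Nat.sub_self,
    zero_add]

open Classical in
theorem decides_adj₂ (hb : b.eval (FinGraph.encodePair p) v < p.2.n) :
    (adj₂ a b).Decides (FinGraph.encodePair p) v
      (p.2.NatAdj (a.eval (FinGraph.encodePair p) v) (b.eval (FinGraph.encodePair p) v)) := by
  rw [Expr.Decides, adj₂, adjExpr, Expr.eval]
  simp only [← FinGraph.getElem?_inr_encodePair p _ hb, Expr.eval, eval_n₁, eval_n₂]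

/-- The truth value of the two graphs having the same numbers of vertices and edges. The double
sums count each edge twice. -/
def sameSize : Expr (Option Bool ⊕ Option Bool) :=
  .mul (.eq n₁ n₂) (.eq (.sum 1 n₁ (.sum 2 n₁ (adj₁ (.var 1) (.var 2))))
    (.sum 1 n₂ (.sum 2 n₂ (adj₂ (.var 1) (.var 2)))))

open Classical in
theorem decides_sameSize : sameSize.Decides (FinGraph.encodePair p) v
    (p.1.n = p.2.n ∧ Nat.card p.1.graph.edgeSet = Nat.card p.2.graph.edgeSet) := by
  refine (Expr.decides_eq.and Expr.decides_eq).congr ?_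
  rw [eval_n₁, eval_n₂]
  have h₁ : (Expr.sum 1 n₁ (.sum 2 n₁ (adj₁ (.var 1) (.var 2)))).eval
      (FinGraph.encodePair p) v = 2 * Nat.card p.1.graph.edgeSet := by
    rw [← FinGraph.sum_natAdj, Expr.eval, eval_n₁]
    refine Finset.sum_congr rfl fun i hi => ?_
    rw [Expr.eval, eval_n₁]
    refine Finset.sum_congr rfl fun j hj => ?_
    rw [decides_adj₁ (by simpa [Expr.eval] using hi) (by simpa [Expr.eval] using hj)]
    simp [Expr.eval]
  have h₂ : (Expr.sum 1 n₂ (.sum 2 n₂ (adj₂ (.var 1) (.var 2)))).eval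
      (FinGraph.encodePair p) v = 2 * Nat.card p.2.graph.edgeSet := by
    rw [← FinGraph.sum_natAdj, Expr.eval, eval_n₂]
    refine Finset.sum_congr rfl fun i hi => ?_
    rw [Expr.eval, eval_n₂]
    refine Finset.sum_congr rfl fun j hj => ?_
    rw [decides_adj₂ (by simpa [Expr.eval] using hj)]
    simp [Expr.eval]
  rw [h₁, h₂, mul_right_inj' two_ne_zero]

/-- The truth value of `GadgetCode.Valid`. -/
def valid (a b : Expr (Option Bool ⊕ Option Bool)) :
    VertexKind → Expr (Option Bool ⊕ Option Bool)
  | .A | .A' => .eq b (.not .one)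
  | .C | .D => .mul (.eq b (.not .one)) (.lt a (.add .one .one))
  | .B => .mul (.lt a b) (.pos (.add (.le n₁ b) (adj₁ a b)))
  | .B' => .mul (.lt a b) (.pos (.add (.le n₂ b) (adj₂ a b)))

open Classical in
/-- The value of `adj` does not matter if `b` is not below the number of vertices; `adj₁` and `adj₂`
then read a symbol outside of row `a`. -/
theorem decides_padAdj {G : FinGraph} {n adj : Expr (Option Bool ⊕ Option Bool)}
    (hn : n.eval (FinGraph.encodePair p) v = G.n)
    (hadj : a.eval (FinGraph.encodePair p) v < G.n → b.eval (FinGraph.encodePair p) v < G.n →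
      adj.Decides (FinGraph.encodePair p) v
        (G.NatAdj (a.eval (FinGraph.encodePair p) v) (b.eval (FinGraph.encodePair p) v))) :
    (Expr.mul (.lt a b) (.pos (.add (.le n b) adj))).Decides (FinGraph.encodePair p) v
      (G.PadAdj (a.eval (FinGraph.encodePair p) v) (b.eval (FinGraph.encodePair p) v)) := by
  by_cases hab : a.eval (FinGraph.encodePair p) v < b.eval (FinGraph.encodePair p) v
  · have h : (Expr.pos (.add (.le n b) adj)).Decides (FinGraph.encodePair p) v
        (G.n ≤ b.eval (FinGraph.encodePair p) v ∨
          G.NatAdj (a.eval (FinGraph.encodePair p) v) (b.eval (FinGraph.encodePair p) v)) := by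
      by_cases hb : b.eval (FinGraph.encodePair p) v < G.n
      · exact (Expr.decides_le.or (hadj (hab.trans hb) hb)).congr (by rw [hn])
      · have hb' := not_lt.1 hb
        refine Expr.decides_pos.congr (iff_of_true ?_ (Or.inl hb'))
        rw [Expr.eval, Expr.decides_le, if_pos (hn.trans_le hb')]
        omega
    exact (Expr.decides_lt.and h).congr Iff.rfl
  · have h := Expr.decides_lt (w := FinGraph.encodePair p) (v := v) (a := a) (b := b)
    rw [Expr.Decides, if_neg hab] at h
    rw [Expr.Decides, Expr.eval, h, zero_mul, if_neg fun h => hab h.1]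

open Classical in
theorem decides_valid (κ : VertexKind) : (valid a b κ).Decides (FinGraph.encodePair p) v
    (GadgetCode.Valid p
      (κ, a.eval (FinGraph.encodePair p) v, b.eval (FinGraph.encodePair p) v)) := by
  cases κ with
  | A => exact Expr.decides_eq.congr Iff.rfl
  | A' => exact Expr.decides_eq.congr Iff.rfl
  | C => exact (Expr.decides_eq.and Expr.decides_lt).congr Iff.rfl
  | B => exact decides_padAdj (eval_n₁ p v) decides_adj₁
  | B' => exact decides_padAdj (eval_n₂ p v) fun _ => decides_adj₂
  | D => exact (Expr.decides_eq.and Expr.decides_lt).congr Iff.rfl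

variable {O : Type}

/-- For all codes of vertices of one kind: put the two numbers into the variables `x` and `y`, and
write `q`. -/
def forKind (x y : ℕ) (κ : VertexKind) (q : WordProg (Option Bool ⊕ Option Bool) O) :
    WordProg (Option Bool ⊕ Option Bool) O :=
  .rep x (.add n₁ (.add .one .one)) (.rep y (.add n₁ (.add .one .one))
    (.cond (valid (.var x) (.var y) κ) q))

/-- For all codes of vertices of the gadget: put the two numbers into the variables `x` and `y`,
and write `q κ`, where `κ` is the kind of the vertex. -/
def forCodes (x y : ℕ) (q : VertexKind → WordProg (Option Bool ⊕ Option Bool) O) :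
    WordProg (Option Bool ⊕ Option Bool) O :=
  .seq (forKind x y .A (q .A)) (.seq (forKind x y .A' (q .A')) (.seq (forKind x y .C (q .C))
    (.seq (forKind x y .B (q .B)) (.seq (forKind x y .B' (q .B')) (forKind x y .D (q .D))))))

open Classical in
theorem eval_forKind {x y : ℕ} (hx : x ≠ 0) (hy : y ≠ 0) (hxy : x ≠ y) (hv : v 0 = 0)
    (κ : VertexKind) (q : WordProg (Option Bool ⊕ Option Bool) O) :
    (forKind x y κ q).eval (FinGraph.encodePair p) v =
      (List.range (p.1.n + 2)).flatMap fun i => (List.range (p.1.n + 2)).flatMap fun j =>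
        if GadgetCode.Valid p (κ, i, j) then
          q.eval (FinGraph.encodePair p) (Function.update (Function.update v x i) y j) else [] := by
  simp only [forKind, WordProg.eval, Expr.eval, eval_n₁]
  refine List.flatMap_congr fun i _ => List.flatMap_congr fun j _ => ?_
  rw [WordProg.eval_cond (decides_valid κ)
    (by rw [Function.update_of_ne hy.symm, Function.update_of_ne hx.symm, hv])]
  simp only [Expr.eval, Function.update_self, Function.update_of_ne hxy]

open Classical in
theorem eval_forCodes {x y : ℕ} (hx : x ≠ 0) (hy : y ≠ 0) (hxy : x ≠ y) (hv : v 0 = 0)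
    (q : VertexKind → WordProg (Option Bool ⊕ Option Bool) O) :
    (forCodes x y q).eval (FinGraph.encodePair p) v = (gadgetCodes p).flatMap fun t =>
      (q t.1).eval (FinGraph.encodePair p)
        (Function.update (Function.update v x t.2.1) y t.2.2) := by
  have h : ∀ l : List VertexKind, ((l ×ˢ (List.range (p.1.n + 2) ×ˢ List.range (p.1.n + 2))).filter
      fun t => decide (GadgetCode.Valid p t)).flatMap (fun t => (q t.1).eval
        (FinGraph.encodePair p) (Function.update (Function.update v x t.2.1) y t.2.2)) =
      l.flatMap fun κ => (forKind x y κ (q κ)).eval (FinGraph.encodePair p) v := fun l => by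
    simp only [List.flatMap_filter_ite, SProd.sprod, List.product, List.flatMap_assoc,
      List.flatMap_map, eval_forKind hx hy hxy hv, decide_eq_true_eq]
  rw [gadgetCodes, h]
  simp only [VertexKind.all, List.flatMap_cons, List.flatMap_nil, List.append_nil, forCodes,
    WordProg.eval]

/-- The truth value of `GadgetCode.LeftRight`, which does not depend on the second number of the
left vertex. -/
def leftRight (a a' b' : Expr (Option Bool ⊕ Option Bool)) :
    VertexKind → VertexKind → Expr (Option Bool ⊕ Option Bool)
  | .A, .B => .pos (.add (.eq a a') (.eq a b'))
  | .A, .D => .one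
  | .A', .B => .one
  | .A', .B' => .not (.pos (.add (.eq a a') (.eq a b')))
  | .C, .B' => .one
  | .C, .D => .eq a a'
  | _, _ => .not .one

open Classical in
theorem decides_leftRight {w : List (Option Bool ⊕ Option Bool)}
    {a a' b' : Expr (Option Bool ⊕ Option Bool)} (κ κ' : VertexKind) (j : ℕ) :
    (leftRight a a' b' κ κ').Decides w v (GadgetCode.LeftRight (κ, a.eval w v, j)
      (κ', a'.eval w v, b'.eval w v)) := by
  cases κ <;> cases κ' <;> first
    | exact Expr.decides_zero.congr Iff.rfl
    | exact Expr.decides_one.congr Iff.rfl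
    | exact Expr.decides_eq.congr Iff.rfl
    | exact (Expr.decides_eq.or Expr.decides_eq).congr Iff.rfl
    | exact (Expr.decides_eq.or Expr.decides_eq).not.congr Iff.rfl

/-- The code of the gadget. -/
def gadgetProg : WordProg (Option Bool ⊕ Option Bool) (Option Bool) :=
  forCodes 1 2 fun κ => .seq
    (forCodes 3 4 fun κ' => .choose
      (.pos (.add (leftRight (.var 1) (.var 3) (.var 4) κ κ')
        (leftRight (.var 3) (.var 1) (.var 2) κ' κ))) (some true) (some false))
    (.emit none)

theorem eval_gadgetProg : gadgetProg.eval (FinGraph.encodePair p) (fun _ => 0) =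
    (FinGraph.ofList codeGraph (gadgetCodes p)).encode := by
  classical
  rw [gadgetProg, eval_forCodes (by decide) (by decide) (by decide) rfl, FinGraph.encode_ofList]
  refine List.flatMap_congr fun t _ => ?_
  rw [WordProg.eval, WordProg.eval, eval_forCodes (by decide) (by decide) (by decide) (by simp),
    ← List.flatMap_singleton' (List.map _ _), List.flatMap_map]
  congr 1
  refine List.flatMap_congr fun t' _ => ?_
  rw [WordProg.eval_choose ((decides_leftRight _ _ t.2.2).or
    (decides_leftRight _ _ t'.2.2)) (by simp)]
  simp only [Expr.eval, Function.update_self, ne_eq, OfNat.one_ne_ofNat,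
    Nat.reduceEqDiff, not_false_eq_true, Function.update_of_ne, codeGraph]
  split_ifs with h <;> simp [h]

/-- The code of `toGadget`. The graph on two vertices without edges is written out. -/
def toGadgetProg : WordProg (Option Bool ⊕ Option Bool) (Option Bool) :=
  .seq
    (.cond (.not sameSize) (.seq (.emit (some false)) (.seq (.emit (some false)) (.seq (.emit none)
      (.seq (.emit (some false)) (.seq (.emit (some false)) (.emit none)))))))
    (.cond (.mul sameSize (.pos n₁)) gadgetProg)

theorem eval_toGadgetProg (p : FinGraph × FinGraph) :
    toGadgetProg.eval (FinGraph.encodePair p) (fun _ => 0) = (toGadget p).encode := by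
  classical
  rw [toGadgetProg, WordProg.eval, WordProg.eval_cond decides_sameSize.not rfl,
    WordProg.eval_cond (decides_sameSize.and Expr.decides_pos) rfl, eval_gadgetProg, eval_n₁]
  by_cases h : p.1.n = p.2.n ∧ Nat.card p.1.graph.edgeSet = Nat.card p.2.graph.edgeSet
  · rw [if_neg (not_not.2 h), List.nil_append, toGadget, if_pos h]
    by_cases h0 : p.1.n = 0
    · rw [if_neg fun h' => h'.2 h0, if_pos h0]
      rfl
    · rw [if_pos ⟨h, h0⟩, if_neg h0]
  · rw [if_pos h, if_neg fun h' => h h'.1, List.append_nil, toGadget, if_neg h]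
    simp [WordProg.eval, FinGraph.encode, FinGraph.encodeRow, List.finRange_succ]

theorem toGadget_isReduction :
    DecisionProblem.IsReduction DecisionProblem.graphIso DecisionProblem.squco toGadget :=
  ⟨polyTime_of_wordProg (I := Option Bool ⊕ Option Bool) (O := Option Bool)
    (ea := FinGraph.encodePair) (eb := FinGraph.encode) toGadgetProg eval_toGadgetProg,
    yes_toGadget⟩

end PairCode

end RegMachine

/-- Recognizing squco graphs is graph isomorphism complete, and a reduction from graph isomorphism
is given by the graphs `H(I(G₁), J)` with `J` the bipartite complement of `I(G₂)`. -/
theorem theorem4p2 :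
    DecisionProblem.GIComplete DecisionProblem.squco ∧
    -- correctness of the construction on graphs of equal order and size that satisfy the two
    -- conditions `m > n > 1` and "no isolated vertices"
    (∀ (V₁ V₂ : Type) [Finite V₁] [Finite V₂] (G₁ : SimpleGraph V₁) (G₂ : SimpleGraph V₂),
      Nat.card V₁ = Nat.card V₂ → Nat.card G₁.edgeSet = Nat.card G₂.edgeSet →
      1 < Nat.card V₁ → Nat.card V₁ < Nat.card G₁.edgeSet →
      G₁.incidence.toGraph.NoIsolated → G₁.incidence.compl.toGraph.NoIsolated →
      G₂.incidence.toGraph.NoIsolated → G₂.incidence.compl.toGraph.NoIsolated →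
      (Nonempty (G₁ ≃g G₂) ↔ (squcoGadget G₁ G₂).IsSquco)) ∧
    -- correctness of the construction after padding by two universal vertices
    (∀ (V₁ V₂ : Type) [Finite V₁] [Finite V₂] [Nonempty V₁] [Nonempty V₂]
      (G₁ : SimpleGraph V₁) (G₂ : SimpleGraph V₂),
      Nat.card V₁ = Nat.card V₂ → Nat.card G₁.edgeSet = Nat.card G₂.edgeSet →
      (Nonempty (G₁ ≃g G₂) ↔ (squcoGadget G₁.pad G₂.pad).IsSquco)) ∧
    -- some polynomial-time reduction outputs, up to isomorphism, the construction on the padded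
    -- graphs, for all pairs of nonempty graphs of equal order and size
    (∃ f : FinGraph × FinGraph → FinGraph,
      DecisionProblem.IsReduction DecisionProblem.graphIso DecisionProblem.squco f ∧
      ∀ G₁ G₂ : FinGraph, 0 < G₁.n → G₁.n = G₂.n →
        Nat.card G₁.graph.edgeSet = Nat.card G₂.graph.edgeSet →
        Nonempty ((f (G₁, G₂)).graph ≃g squcoGadget G₁.graph.pad G₂.graph.pad)) := by
  refine ⟨⟨⟨_, RegMachine.PairCode.toGadget_isReduction⟩, ⟨_, RegMachine.squareCompl_isReduction⟩⟩,
    ?_, ?_, toGadget, RegMachine.PairCode.toGadget_isReduction, ?_⟩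
  · intro V₁ V₂ _ _ G₁ G₂ hV hE hn hVE h₁ h₁' h₂ h₂'
    have : Nonempty V₁ := (Nat.card_pos_iff.1 (by omega)).1
    exact ⟨fun ⟨e⟩ => isSquco_gadget_of_iso h₁ h₂' e,
      iso_of_isSquco_gadget hV hE hVE h₁ h₁' h₂ h₂'⟩
  · intro V₁ V₂ _ _ _ _ G₁ G₂ hV hE
    exact gadget_pad_iff G₁ G₂ hV hE
  · intro G₁ G₂ h0 hn hE
    rw [toGadget_of_pos hn hE h0.ne']
    exact ofList_iso_gadget (G₁, G₂) hn
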